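/- Setup. A polytope $P\subset\mathbb R^d$ is the convex hull of a finite set; its faces are the maximal loci of linear functionals, and $\operatorname{Lin}F$ is the span of the differences of points of a face $F$. A frame is an ordered basis $(v_1,\dots,v_d)$ of $\mathbb R^d$; put $V_k=\langle v_1,\dots,v_k\rangle$ and let $\pi_k:\mathbb R^d\to V_k$ fix $v_i$ for $i\le k$ and kill $v_i$ for $i>k$. The frame is $P$-admissible, and $P$ is framed by it, if $\pi_k:\operatorname{Lin}F\to V_k$ is an isomorphism for every $k$-face $F$; then $F$ is oriented by $\beta_F=\sigma(v_1)\wedge\dots\wedge\sigma(v_k)$ with $\sigma=(\pi_k|_{\operatorname{Lin}F})^{-1}$ (and $\beta_F=1$ for $k=0$). The source $s(F)$ (resp. target $t(F)$) is the set of facets $E$ of $F$ such that $\beta_F$ is a positive multiple of $\beta_E\wedge w$ for some inner-pointing (resp. outer-pointing) vector $w\in\operatorname{Lin}F$. An inhomogeneous cellular loop is a finite sequence of faces $F_1,\dots,F_m$ with $F_i\in s(F_{i+1})$ or $F_{i+1}\in t(F_i)$ for all $i<m$, and $F_i=F_j$ for some $i\ne j$. The chain complex of a framed polytope has as basis in degree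 $k$ the $k$-faces, $\partial F=\sum t(F)-\sum s(F)$, and augmentation $1$ on vertices. A based augmented chain complex is a non-negatively graded complex of free abelian groups $C_n=\mathbb Z\{B_n\}$ with given bases $B_n$ and with $\varepsilon:C_0\to\mathbb Z$, $\varepsilon\partial=0$, $\varepsilon(b)=1$ for $b\in B_0$; morphisms are augmentation-preserving chain maps sending basis elements to non-negative combinations of basis elements. Write $\partial c=\partial^+c-\partial^-c$ for the decomposition into positive and negative parts, and for a basis element $b$ of degree $n$ and $k\le n$ put $\langle b\rangle_k^{\pm}=(\partial^{\pm})^{n-k}b$. The complex is a Steiner diagram if $\varepsilon\langle b\rangle_0^{\pm}=1$ for all basis elements $b$ and, for each $k\ge0$, the transitive closure of the following relation $<_k$ is antisymmetric: $b<_kb'$ if $b,b'$ have degree $>k$ and some basis element occurs in both $\langle b\rangle_k^+$ and $\langle b'\rangle_k^-$. It is a strong Steiner diagram if moreover the transitive closure of the relation "$b$ occurs in $\partial^-b'$ or $b'$ occurs in $\partial^+b$" is antisymmetric. For $t_1<\dots<t_n$ real and $n\ge d\ge 0$, the cyclic zonotope $Z(n,d)\subset\mathbb R^d$ is the Minkowski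 sum of the segments from $0$ to $\xi(t_i)=(1,t_i,\dots,t_i^{d-1})$, $1\le i\le n$; the cyclic $d$-cube is $Z(d)=Z(d,d)$. Let $C(\mathbb I)$ be the based augmented complex with basis $[0],[1]$ in degree $0$ and $[0,1]$ in degree $1$, with $\partial[0,1]=[1]-[0]$. The cubical $d$-oriental is its $d$-fold tensor power $C(\mathbb I)^{\otimes d}$, with $\partial(x\otimes y)=\partial x\otimes y+(-1)^{|x|}x\otimes\partial y$ and with the tensors of basis elements as basis. Theorem. (1) For every $d\ge 0$, the frame $(e_1,-e_2,\dots,(-1)^{d-1}e_d)$ is $Z(d)$-admissible, and $Z(d)$ framed by it has no inhomogeneous cellular loops. Its chain complex is a strong Steiner diagram, and it is isomorphic, as a based augmented chain complex, to the cubical $d$-oriental $C(\mathbb I)^{\otimes d}$. (2) For all $n\ge d\ge 0$, the canonical frame $(e_1,\dots,e_d)$ is $Z(n,d)$-admissible, and the chain complex of $Z(n,d)$ framed by it is a strong Steiner diagram. -/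

import Mathlib

open scoped Pointwise

noncomputable section

/-! ### Polytopes and their faces -/

namespace FramedPolytope

variable {d : ℕ}

/-- A polytope in `ℝ^d`: the convex hull of a finite set of points. -/
def IsPolytope (P : Set (Fin d → ℝ)) : Prop :=
  ∃ S : Finset (Fin d → ℝ), P = convexHull ℝ (S : Set (Fin d → ℝ))

/-- The maximal locus `P^φ` of a linear functional `φ` on `P`. -/
def maxLocus (P : Set (Fin d → ℝ)) (φ : Module.Dual ℝ (Fin d → ℝ)) : Set (Fin d → ℝ) :=
  {x | x ∈ P ∧ ∀ y ∈ P, φ y ≤ φ x}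

/-- `F` is a non-empty face of `P`. -/
def IsFace (P F : Set (Fin d → ℝ)) : Prop :=
  F.Nonempty ∧ ∃ φ : Module.Dual ℝ (Fin d → ℝ), F = maxLocus P φ

/-- The type of non-empty faces of `P`. -/
abbrev Face (P : Set (Fin d → ℝ)) : Type := {F : Set (Fin d → ℝ) // IsFace P F}

/-- The linear span `Lin P`: the span of all differences `x - y` with `x, y ∈ P`. -/
abbrev lin (P : Set (Fin d → ℝ)) : Submodule ℝ (Fin d → ℝ) := vectorSpan ℝ P

/-- The dimension of a (non-empty) polytope. -/
def dim (P : Set (Fin d → ℝ)) : ℕ := Module.finrank ℝ (lin P)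

lemma dim_le (P : Set (Fin d → ℝ)) : dim P ≤ d := by
  simpa [dim] using Submodule.finrank_le (lin P)

/-- `E` is a facet of `P`: a face of codimension one. -/
def IsFacet (P E : Set (Fin d → ℝ)) : Prop := IsFace P E ∧ dim E + 1 = dim P

/-- The normal cone of the face `F` of `P`: all functionals whose maximal locus on `P` is `F`. -/
def normalCone (P F : Set (Fin d → ℝ)) : Set (Module.Dual ℝ (Fin d → ℝ)) :=
  {ψ | F = maxLocus P ψ}

/-! ### Orientations, sources and targets -/

/-- Two multivectors are equivalent if they differ by a positive scalar. -/
def SameOrientation (β β' : ExteriorAlgebra ℝ (Fin d → ℝ)) : Prop :=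
  ∃ c : ℝ, 0 < c ∧ β = c • β'

/-- The source of a polytope `F`, for a choice `β` of generators of the top exterior powers of the
linear spans of the faces: the facets `E` such that `β_F ∼ β_E ∧ w` for an inner-pointing `w`. -/
def source (β : Set (Fin d → ℝ) → ExteriorAlgebra ℝ (Fin d → ℝ)) (F : Set (Fin d → ℝ)) :
    Set (Set (Fin d → ℝ)) :=
  {E | IsFacet F E ∧ ∃ w ∈ lin F, ∃ ν ∈ normalCone F E,
    ν w < 0 ∧ SameOrientation (β F) (β E * ExteriorAlgebra.ι ℝ w)}

/-- The target of a polytope `F`: as the source, with an outer-pointing vector. -/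
def target (β : Set (Fin d → ℝ) → ExteriorAlgebra ℝ (Fin d → ℝ)) (F : Set (Fin d → ℝ)) :
    Set (Set (Fin d → ℝ)) :=
  {E | IsFacet F E ∧ ∃ w ∈ lin F, ∃ ν ∈ normalCone F E,
    0 < ν w ∧ SameOrientation (β F) (β E * ExteriorAlgebra.ι ℝ w)}

/-! ### Frames -/

/-- A frame: an ordered basis of `ℝ^d`. -/
abbrev Frame (d : ℕ) : Type := Module.Basis (Fin d) ℝ (Fin d → ℝ)

/-- `V_k`, the span of the first `k` vectors of the frame. -/
def frameSpan (v : Frame d) (k : ℕ) : Submodule ℝ (Fin d → ℝ) :=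
  Submodule.span ℝ {x | ∃ i : Fin d, (i : ℕ) < k ∧ x = v i}

/-- The projection `π_k`, which fixes the first `k` vectors of the frame and kills the others. -/
def proj (v : Frame d) (k : ℕ) : (Fin d → ℝ) →ₗ[ℝ] (Fin d → ℝ) :=
  v.constr ℝ fun i : Fin d => if (i : ℕ) < k then v i else 0

/-- The frame `v` is `P`-admissible: for each face `F`, with `k = dim F`, the projection `π_k`
restricts to an isomorphism from `Lin F` onto `V_k`. -/
def IsAdmissible (P : Set (Fin d → ℝ)) (v : Frame d) : Prop :=
  ∀ F : Set (Fin d → ℝ), IsFace P F →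
    Set.BijOn (proj v (dim F)) (lin F) (frameSpan v (dim F))

/-- `P` is a polytope framed by `v`. -/
def IsFramed (P : Set (Fin d → ℝ)) (v : Frame d) : Prop := IsPolytope P ∧ IsAdmissible P v

/-- The inverse `σ_k^F` of the restriction `π_k : Lin F → V_k`, where `k = dim F`. -/
def lift (v : Frame d) (F : Set (Fin d → ℝ)) : (Fin d → ℝ) → (Fin d → ℝ) :=
  Function.invFunOn (proj v (dim F)) (lin F)

/-- The induced orientation `β_F = σ_k^F(v_1) ∧ ⋯ ∧ σ_k^F(v_k)` with `k = dim F`; it is `1` for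
`k = 0`. -/
def inducedOrientation (v : Frame d) (F : Set (Fin d → ℝ)) : ExteriorAlgebra ℝ (Fin d → ℝ) :=
  ExteriorAlgebra.ιMulti ℝ (dim F) fun i : Fin (dim F) => lift v F (v (Fin.castLE (dim_le F) i))

/-- The source of a face of a framed polytope. -/
def src (P : Set (Fin d → ℝ)) (v : Frame d) (F : Face P) : Set (Face P) :=
  {E | (E : Set (Fin d → ℝ)) ∈ source (inducedOrientation v) F}

/-- The target of a face of a framed polytope. -/
def tgt (P : Set (Fin d → ℝ)) (v : Frame d) (F : Face P) : Set (Face P) :=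
  {E | (E : Set (Fin d → ℝ)) ∈ target (inducedOrientation v) F}

/-- An inhomogeneous cellular string: a finite sequence of faces in which any two consecutive
members `F, G` satisfy `F ∈ s(G)` or `G ∈ t(F)`. -/
def IsInhomogeneousString (P : Set (Fin d → ℝ)) (v : Frame d) (l : List (Face P)) : Prop :=
  l.IsChain fun F G => F ∈ src P v G ∨ G ∈ tgt P v F

/-- An inhomogeneous cellular loop: an inhomogeneous cellular string with a repeated face. -/
def IsInhomogeneousLoop (P : Set (Fin d → ℝ)) (v : Frame d) (l : List (Face P)) : Prop :=
  IsInhomogeneousString P v l ∧ ¬ l.Nodup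

end FramedPolytope

/-! ### Based augmented chain complexes -/

/-- A graded set `B`, given by its total set and a degree function, with an additive endomorphism
`bd` of the free abelian group on `B`. See `IsComplex` for the laws. -/
structure BasedChainData where
  B : Type
  deg : B → ℕ
  bd : (B →₀ ℤ) →ₗ[ℤ] (B →₀ ℤ)

namespace BasedChainData

/-- The augmentation: `1` on each basis element of degree `0`, extended by zero to the chains of
positive degree. -/
def aug (C : BasedChainData) : (C.B →₀ ℤ) →ₗ[ℤ] ℤ :=
  Finsupp.linearCombination ℤ fun b => if C.deg b = 0 then 1 else 0

/-- `C` is a based augmented chain complex: the boundary lowers the degree by one (and vanishes in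
degree zero), `∂ ∘ ∂ = 0` and `ε ∘ ∂ = 0`. -/
structure IsComplex (C : BasedChainData) : Prop where
  bd_deg : ∀ b b' : C.B, C.bd (Finsupp.single b 1) b' ≠ 0 → C.deg b' + 1 = C.deg b
  bd_bd : ∀ c, C.bd (C.bd c) = 0
  aug_bd : ∀ c, C.aug (C.bd c) = 0

/-- `∂⁺ c` and `∂⁻ c` (for `s = true` and `s = false`): the positive and the negative part of `∂ c`
with respect to the basis, so that `∂ c = ∂⁺ c - ∂⁻ c`. -/
def bdPart (C : BasedChainData) (s : Bool) (c : C.B →₀ ℤ) : C.B →₀ ℤ :=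
  if s then C.bd c ⊔ 0 else (-C.bd c) ⊔ 0

/-- The chain `⟨b⟩_k^±` for a basis element `b` and `k ≤ deg b`, got by applying `∂^±` to `b`
as many times as needed to reach degree `k`. -/
def atom (C : BasedChainData) (s : Bool) (b : C.B) (k : ℕ) : C.B →₀ ℤ :=
  (C.bdPart s)^[C.deg b - k] (Finsupp.single b 1)

/-- The basis is unital: `ε ⟨b⟩_0^± = 1` for all basis elements `b`. -/
def IsUnital (C : BasedChainData) : Prop :=
  ∀ (s : Bool) (b : C.B), C.aug (C.atom s b 0) = 1

/-- The relation `b <_k b'` on basis elements of degree greater than `k`. -/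
def ltAt (C : BasedChainData) (k : ℕ) (b b' : C.B) : Prop :=
  k < C.deg b ∧ k < C.deg b' ∧ ∃ e : C.B, C.atom true b k e ≠ 0 ∧ C.atom false b' k e ≠ 0

/-- The basis is loop-free: the transitive closure of each `<_k` is antisymmetric. -/
def IsLoopFree (C : BasedChainData) : Prop :=
  ∀ (k : ℕ) (b b' : C.B),
    Relation.TransGen (C.ltAt k) b b' → Relation.TransGen (C.ltAt k) b' b → b = b'

/-- The relation `b <_ℕ b'`: `b` occurs in `∂⁻ b'` or `b'` occurs in `∂⁺ b`. -/
def ltN (C : BasedChainData) (b b' : C.B) : Prop :=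
  C.bdPart false (Finsupp.single b' 1) b ≠ 0 ∨ C.bdPart true (Finsupp.single b 1) b' ≠ 0

/-- The basis is strongly loop-free: the transitive closure of `<_ℕ` is antisymmetric. -/
def IsStronglyLoopFree (C : BasedChainData) : Prop :=
  ∀ b b' : C.B, Relation.TransGen C.ltN b b' → Relation.TransGen C.ltN b' b → b = b'

/-- A Steiner diagram: a based augmented chain complex with a unital and loop-free basis. -/
def IsSteiner (C : BasedChainData) : Prop :=
  C.IsComplex ∧ C.IsUnital ∧ C.IsLoopFree

/-- A strong Steiner diagram: a Steiner diagram whose basis is strongly loop-free. -/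
def IsStrongSteiner (C : BasedChainData) : Prop :=
  C.IsSteiner ∧ C.IsStronglyLoopFree

/-- An augmentation-preserving non-negative chain map. -/
structure Hom (C D : BasedChainData) where
  map : (C.B →₀ ℤ) →ₗ[ℤ] (D.B →₀ ℤ)
  map_deg : ∀ (b : C.B) (b' : D.B), map (Finsupp.single b 1) b' ≠ 0 → D.deg b' = C.deg b
  map_bd : ∀ c, map (C.bd c) = D.bd (map c)
  map_aug : ∀ c, D.aug (map c) = C.aug c
  map_nonneg : ∀ b : C.B, 0 ≤ map (Finsupp.single b 1)

/-- Isomorphism in the category of based augmented chain complexes and augmentation-preserving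
non-negative chain maps. -/
def Isomorphic (C D : BasedChainData) : Prop :=
  ∃ (f : Hom C D) (g : Hom D C), g.map ∘ₗ f.map = LinearMap.id ∧ f.map ∘ₗ g.map = LinearMap.id

/-! ### Tensor products and cubical orientals -/

/-- The tensor product of chains, on bases: `x ⊗ y`. -/
def tmul {B B' : Type} (x : B →₀ ℤ) (y : B' →₀ ℤ) : B × B' →₀ ℤ :=
  x.sum fun b m => y.sum fun b' n => Finsupp.single (b, b') (m * n)

/-- The (Gray) tensor product, with basis the pairs `b ⊗ b'` and
`∂(b ⊗ b') = ∂b ⊗ b' + (-1)^{deg b} b ⊗ ∂b'`. -/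
def tensor (C D : BasedChainData) : BasedChainData where
  B := C.B × D.B
  deg p := C.deg p.1 + D.deg p.2
  bd := Finsupp.linearCombination ℤ fun p =>
    tmul (C.bd (Finsupp.single p.1 1)) (Finsupp.single p.2 1) +
      (-1 : ℤ) ^ C.deg p.1 • tmul (Finsupp.single p.1 1) (D.bd (Finsupp.single p.2 1))

/-- The unit of the tensor product: `ℤ` in degree zero. -/
def unit : BasedChainData where
  B := Unit
  deg _ := 0
  bd := 0

/-- The faces of the interval: `[0]`, `[1]` and `[0,1]`. -/
inductive IntervalCell : Type
  | zero
  | one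
  | top

/-- The chain complex of the interval: `∂[0,1] = [1] - [0]`. -/
def interval : BasedChainData where
  B := IntervalCell
  deg
    | .zero => 0
    | .one => 0
    | .top => 1
  bd := Finsupp.linearCombination ℤ fun
    | .zero => 0
    | .one => 0
    | .top => Finsupp.single .one 1 - Finsupp.single .zero 1

/-- The cubical `d`-oriental: the `d`-fold tensor power of the interval. -/
def cubicalOriental : ℕ → BasedChainData
  | 0 => unit
  | d + 1 => tensor (cubicalOriental d) interval

end BasedChainData

namespace FramedPolytope

/-- The chain complex of a framed polytope: generated by the non-empty faces, graded by dimension,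
with `∂F = ∑ t(F) - ∑ s(F)`. The sums are finite since a polytope has finitely many faces. -/
def chains {d : ℕ} (P : Set (Fin d → ℝ)) (v : Frame d) : BasedChainData where
  B := Face P
  deg F := dim (F : Set (Fin d → ℝ))
  bd := Finsupp.linearCombination ℤ fun F =>
    (∑ᶠ E ∈ tgt P v F, Finsupp.single E 1) - ∑ᶠ E ∈ src P v F, Finsupp.single E 1

/-! ### Cyclic zonotopes -/

/-- The Veronese curve `t ↦ (1, t, …, t^{d-1})`. -/
def veronese (d : ℕ) (t : ℝ) : Fin d → ℝ := fun j => t ^ (j : ℕ)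

/-- The cyclic zonotope with parameters `t_1, …, t_n` in `ℝ^d`: the Minkowski sum of the segments
from the origin to the points `(1, t_i, …, t_i^{d-1})`. -/
def cyclicZonotope (d : ℕ) {n : ℕ} (t : Fin n → ℝ) : Set (Fin d → ℝ) :=
  ∑ i : Fin n, segment ℝ 0 (veronese d (t i))

/-- The canonical frame `(e_1, …, e_d)`. -/
def canonicalFrame (d : ℕ) : Frame d := Pi.basisFun ℝ (Fin d)

/-- The frame `(e_1, -e_2, …, (-1)^{d-1} e_d)`. -/
def alternatingFrame (d : ℕ) : Frame d :=
  (Pi.basisFun ℝ (Fin d)).unitsSMul fun i => (-1 : ℝˣ) ^ (i : ℕ)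

end FramedPolytope

end

/-! A face of the cyclic zonotope is recorded by the sign vector of a functional on the generators
`ξ(t i)`, that is, by the signs at the nodes `t i` of a polynomial of degree less than `d`. Sign
vectors in `{0, 1, -1}^n` are also the cells of the `n`-cube, zeros marking the free directions. Any
`d` generators are independent (Vandermonde), so a face with `m` zeros has dimension `min d m`, and
a `k`-face projects isomorphically onto its first `k` coordinates: diagonal frames are admissible.

Let `Y` be a facet of `X`, with `m` zeros, and let `X i = 0`. A quotient of two Vandermonde
determinants gives `β_Y ∧ ξ(t i) = ρ(m)⁻¹ ∏ (t i - t j) β_X`, the product running over the zeros `j`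
of `Y` and `ρ` being the scale of the frame (`inducedOrientation_mul_ι`). Hence `Y` is a target or
source of `X` exactly when each newly nonzero sign of `Y` is plus or minus the sign of this scalar.
For the canonical frame that sign counts the zeros of `Y` after `i`, for the alternating frame those
before `i`. These are the Koszul signs of the tensor power of the interval, for the two orders of
its factors (`cubical_rel_word`, `cubical_rel_word_rev`). Conversely, perturbing a functional by a
nodal polynomial shows that no cell of the cube of degree less than `d` obeying the sign rule is
missing from the zonotope (`exists_face_of_signRel`). So the complex of the zonotope is the complex
of the cube truncated at `d` (`isTruncation_chains`).

For the cube, induction on the tensor factors describes the source and target of every cell in every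
dimension as a sum of distinct cells, together with an integer rank that falls on passing to a
source and rises on passing to a target. This survives truncation. The description gives unitality;
the rank gives both loop-freeness conditions and excludes cellular loops. For `n = d` every sign
vector is realized and nothing is truncated, which yields the isomorphism. -/

noncomputable section

namespace BasedChainData

/-! ### Atoms of cubical complexes -/

/-- A description of all the atoms of a based complex: `chain s k w` is the `k`-dimensional source
(`s = false`) or target (`s = true`) of `w`, and is the sum of the cells `x` of degree `k` with
`rel s w x`. The function `rank` witnesses strong loop-freeness. -/
structure AtomSystem (C : BasedChainData) where
  rel : Bool → C.B → C.B → Prop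
  rank : C.B → ℤ
  chain : Bool → ℤ → C.B → (C.B →₀ ℤ)
  rel_refl : ∀ s w, rel s w w
  deg_lt : ∀ {s w x}, rel s w x → x = w ∨ C.deg x < C.deg w
  rank_lt : ∀ {s w x}, rel s w x → x = w ∨ (if s then rank w < rank x else rank x < rank w)
  chain_pos : ∀ {s k w x}, (C.deg x : ℤ) = k → rel s w x → chain s k w x = 1
  chain_zero : ∀ {s k w x}, ¬ ((C.deg x : ℤ) = k ∧ rel s w x) → chain s k w x = 0
  bd_chain : ∀ s k w, C.bd (chain s k w) = chain true (k - 1) w - chain false (k - 1) w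
  aug_chain : ∀ s w, C.aug (chain s 0 w) = 1

namespace AtomSystem

variable {C : BasedChainData} (A : AtomSystem C)

lemma chain_ne_zero {s : Bool} {k : ℤ} {w x : C.B} (h : A.chain s k w x ≠ 0) :
    (C.deg x : ℤ) = k ∧ A.rel s w x := by
  by_contra h'
  exact h (A.chain_zero h')

lemma chain_nonneg (s : Bool) (k : ℤ) (w x : C.B) : 0 ≤ A.chain s k w x := by
  by_cases h : (C.deg x : ℤ) = k ∧ A.rel s w x
  · rw [A.chain_pos h.1 h.2]; exact zero_le_one
  · rw [A.chain_zero h]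

lemma chain_deg (s : Bool) (w : C.B) : A.chain s (C.deg w) w = Finsupp.single w 1 := by
  ext x
  by_cases hx : x = w
  · subst hx
    rw [A.chain_pos rfl (A.rel_refl s x), Finsupp.single_eq_same]
  · rw [Finsupp.single_eq_of_ne hx]
    apply A.chain_zero
    rintro ⟨h, h'⟩
    rcases A.deg_lt h' with h' | h'
    · exact hx h'
    · exact h'.ne (by exact_mod_cast h)

/-- Indexing by integers lets `bd_chain` hold at `k = 0` too, where the chains of index `-1` vanish.
-/
lemma chain_eq_zero {s : Bool} {k : ℤ} {w : C.B} (h : k < 0 ∨ (C.deg w : ℤ) < k) :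
    A.chain s k w = 0 := by
  ext x
  apply A.chain_zero
  rintro ⟨h1, h2⟩
  rcases A.deg_lt h2 with h' | h'
  · subst h'; omega
  · omega

lemma bd_single (w : C.B) : C.bd (Finsupp.single w 1) =
    A.chain true (C.deg w - 1) w - A.chain false (C.deg w - 1) w := by
  rw [← A.chain_deg true, A.bd_chain]

lemma not_rel_both {w x : C.B} (hx : x ≠ w) : ¬ (A.rel true w x ∧ A.rel false w x) := by
  rintro ⟨h1, h2⟩
  have h1 := (A.rank_lt h1).resolve_left hx
  have h2 := (A.rank_lt h2).resolve_left hx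
  simp only [if_true, Bool.false_eq_true, if_false] at h1 h2
  omega

/-- A common cell would have rank both above and below that of `w`. So nothing cancels in target
minus source, and the two are recovered as its positive and negative parts. -/
lemma chain_disjoint {k : ℤ} {w : C.B} (hk : k < C.deg w) (x : C.B) :
    A.chain true k w x = 0 ∨ A.chain false k w x = 0 := by
  by_contra! h
  have h1 := A.chain_ne_zero h.1
  have h2 := A.chain_ne_zero h.2
  refine A.not_rel_both ?_ ⟨h1.2, h2.2⟩
  rintro rfl
  exact hk.ne' h1.1

end AtomSystem

/-! ### Tensoring with the interval -/

section TensorCell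

variable (C : BasedChainData)

/-- The basis element `w ⊗ [a]`. -/
def pair (w : C.B) (a : IntervalCell) : (tensor C interval).B := ((w, a) : C.B × IntervalCell)

lemma exists_pair (p : (tensor C interval).B) : ∃ w a, p = pair C w a := ⟨p.1, p.2, rfl⟩

lemma pair_injective {w x : C.B} {a b : IntervalCell} (h : pair C w a = pair C x b) :
    w = x ∧ a = b := Prod.mk.inj h

/-- The degree of a cell of the interval. -/
def IntervalCell.dim : IntervalCell → ℕ
  | .zero => 0
  | .one => 0
  | .top => 1

lemma tensor_deg (w : C.B) (a : IntervalCell) :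
    (tensor C interval).deg (pair C w a) = C.deg w + IntervalCell.dim a := by
  cases a <;> rfl

/-- The map `x ↦ x ⊗ [a]`. -/
def tensorCell (a : IntervalCell) : (C.B →₀ ℤ) →ₗ[ℤ] ((tensor C interval).B →₀ ℤ) :=
  Finsupp.lmapDomain ℤ ℤ fun b => pair C b a

lemma tensorCell_single (a : IntervalCell) (b : C.B) (m : ℤ) :
    tensorCell C a (Finsupp.single b m) = Finsupp.single (pair C b a) m := by
  rw [tensorCell, Finsupp.lmapDomain_apply, Finsupp.mapDomain_single]

lemma tensorCell_apply_same (a : IntervalCell) (x : C.B →₀ ℤ) (b : C.B) :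
    tensorCell C a x (pair C b a) = x b := by
  have : Function.Injective fun b : C.B => pair C b a := fun _ _ h => (pair_injective C h).1
  exact Finsupp.mapDomain_apply this x b

lemma tensorCell_apply_ne {a a' : IntervalCell} (h : a' ≠ a) (x : C.B →₀ ℤ) (b : C.B) :
    tensorCell C a x (pair C b a') = 0 := by
  apply Finsupp.mapDomain_of_notMem_range
  rintro ⟨b', hb'⟩
  exact h (pair_injective C hb').2.symm

lemma tmul_single_right {B B' : Type} (x : B →₀ ℤ) (a : B') :
    tmul x (Finsupp.single a 1) = x.mapDomain fun b => (b, a) := by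
  simp only [tmul, Finsupp.mapDomain]
  refine Finsupp.sum_congr fun b _ => ?_
  rw [Finsupp.sum_single_index] <;> simp

lemma tmul_single_left {B B' : Type} (b : B) (y : B' →₀ ℤ) :
    tmul (Finsupp.single b 1) y = y.mapDomain fun a => (b, a) := by
  simp only [tmul, Finsupp.mapDomain]
  rw [Finsupp.sum_single_index] <;> simp

lemma linearCombination_single_one {B M : Type} [AddCommGroup M] (g : B → M) (b : B) :
    Finsupp.linearCombination ℤ g (Finsupp.single b 1) = g b := by
  rw [Finsupp.linearCombination_single, one_smul]

lemma bd_tensor_single (b : C.B) (a : IntervalCell) (c : IntervalCell →₀ ℤ)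
    (hc : interval.bd (Finsupp.single (a : interval.B) 1) = c) :
    (tensor C interval).bd (Finsupp.single (pair C b a) 1) =
      tensorCell C a (C.bd (Finsupp.single b 1)) +
        (-1 : ℤ) ^ C.deg b • c.mapDomain (pair C b) := by
  subst hc
  have h1 := tmul_single_left b (interval.bd (Finsupp.single (a : interval.B) 1))
  have h2 := tmul_single_right (C.bd (Finsupp.single b 1)) (a : interval.B)
  refine Eq.trans (linearCombination_single_one (B := C.B × IntervalCell)
    (M := C.B × IntervalCell →₀ ℤ) _ (b, a)) ?_
  exact congrArg₂ (fun u v => u + (-1 : ℤ) ^ C.deg b • v) h2 h1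

lemma interval_bd_zero : interval.bd (Finsupp.single (IntervalCell.zero : interval.B) 1) = 0 :=
  linearCombination_single_one (B := IntervalCell) (M := IntervalCell →₀ ℤ) _ _

lemma interval_bd_one : interval.bd (Finsupp.single (IntervalCell.one : interval.B) 1) = 0 :=
  linearCombination_single_one (B := IntervalCell) (M := IntervalCell →₀ ℤ) _ _

lemma interval_bd_top : interval.bd (Finsupp.single (IntervalCell.top : interval.B) 1) =
    (Finsupp.single .one 1 - Finsupp.single .zero 1 : IntervalCell →₀ ℤ) :=
  linearCombination_single_one (B := IntervalCell) (M := IntervalCell →₀ ℤ) _ _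

lemma single_eq_smul {B : Type} (b : B) (m : ℤ) :
    Finsupp.single b m = m • Finsupp.single b (1 : ℤ) := by
  rw [Finsupp.smul_single, smul_eq_mul, mul_one]

lemma bd_tensorCell_zero (x : C.B →₀ ℤ) :
    (tensor C interval).bd (tensorCell C .zero x) = tensorCell C .zero (C.bd x) := by
  induction x using Finsupp.induction_linear with
  | zero => simp only [map_zero]
  | add x y hx hy => simp only [map_add, hx, hy]
  | single b m =>
    rw [single_eq_smul]
    simp only [map_smul]
    rw [tensorCell_single, bd_tensor_single C b .zero 0 interval_bd_zero, Finsupp.mapDomain_zero,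
      smul_zero, add_zero]

lemma bd_tensorCell_one (x : C.B →₀ ℤ) :
    (tensor C interval).bd (tensorCell C .one x) = tensorCell C .one (C.bd x) := by
  induction x using Finsupp.induction_linear with
  | zero => simp only [map_zero]
  | add x y hx hy => simp only [map_add, hx, hy]
  | single b m =>
    rw [single_eq_smul]
    simp only [map_smul]
    rw [tensorCell_single, bd_tensor_single C b .one 0 interval_bd_one, Finsupp.mapDomain_zero,
      smul_zero, add_zero]

/-- The involution multiplying the chains of degree `k` by `(-1) ^ k`. -/
def degreeSign : (C.B →₀ ℤ) →ₗ[ℤ] (C.B →₀ ℤ) :=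
  Finsupp.linearCombination ℤ fun b => (-1 : ℤ) ^ C.deg b • Finsupp.single b 1

/-- The Koszul sign depends on the degree of the left factor, so the two endpoints exchange roles in
odd degree; `endpoint` records this. -/
lemma bd_tensorCell_top (x : C.B →₀ ℤ) :
    (tensor C interval).bd (tensorCell C .top x) = tensorCell C .top (C.bd x) +
      (tensorCell C .one (degreeSign C x) - tensorCell C .zero (degreeSign C x)) := by
  induction x using Finsupp.induction_linear with
  | zero => simp only [map_zero, sub_zero, add_zero]
  | add x y hx hy => simp only [map_add, hx, hy]; abel
  | single b m =>
    rw [single_eq_smul]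
    simp only [map_smul]
    rw [← smul_sub, ← smul_add, tensorCell_single, bd_tensor_single C b .top _ interval_bd_top,
      Finsupp.mapDomain_sub, Finsupp.mapDomain_single, Finsupp.mapDomain_single, degreeSign,
      Finsupp.linearCombination_single, one_smul, map_smul, map_smul, tensorCell_single,
      tensorCell_single, smul_sub]

lemma degreeSign_of_homogeneous {x : C.B →₀ ℤ} {k : ℤ} (hx : ∀ b, x b ≠ 0 → (C.deg b : ℤ) = k) :
    degreeSign C x = if Even k then x else -x := by
  have h : degreeSign C x = x.sum fun b m => Finsupp.single b (if Even k then m else -m) := by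
    rw [degreeSign, Finsupp.linearCombination_apply]
    refine Finsupp.sum_congr fun b hb => ?_
    have hk := hx b (Finsupp.mem_support_iff.mp hb)
    subst hk
    by_cases he : Even (C.deg b)
    · simp [he, he.neg_one_pow]
    · simp [he, (Nat.not_even_iff_odd.mp he).neg_one_pow]
  rw [h]
  split_ifs with he
  · exact Finsupp.sum_single x
  · simp only [Finsupp.single_neg, Finsupp.sum_neg]
    rw [Finsupp.sum_single]

lemma aug_tensorCell {a : IntervalCell} (ha : a ≠ .top) (x : C.B →₀ ℤ) :
    (tensor C interval).aug (tensorCell C a x) = C.aug x := by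
  have hdeg : ∀ b : C.B, (tensor C interval).deg (pair C b a) = C.deg b := by
    intro b
    rw [tensor_deg]
    cases a <;> simp_all [IntervalCell.dim]
  induction x using Finsupp.induction_linear with
  | zero => simp only [map_zero]
  | add x y hx hy => simp only [map_add, hx, hy]
  | single b m =>
    rw [tensorCell_single, aug, aug, Finsupp.linearCombination_single,
      Finsupp.linearCombination_single, hdeg]

end TensorCell

/-- The endpoint `[1]` or `[0]` selected by the sign `s · (-1) ^ k`. -/
def endpoint (s : Bool) (k : ℤ) : IntervalCell := if (Even k ↔ s = true) then .one else .zero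

lemma endpoint_ne_top (s : Bool) (k : ℤ) : endpoint s k ≠ .top := by
  unfold endpoint; split_ifs <;> simp

/-- The sign of a cell of the interval, the open cell having sign zero. -/
def IntervalCell.val : IntervalCell → ℤ
  | .zero => -1
  | .one => 1
  | .top => 0

/-! ### The atoms of a product with the interval -/

namespace AtomSystem

variable {C : BasedChainData} (A : AtomSystem C)

/-- The relation of the product atom system. -/
def tensorRel (s : Bool) (w : C.B) (a : IntervalCell) (x : C.B) (b : IntervalCell) : Prop :=
  A.rel s w x ∧ (a = .top → b = .top ∨ b = endpoint s (C.deg x)) ∧ (a ≠ .top → b = a)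

/-- The rank function of the product atom system. -/
def tensorRank (w : C.B) (a : IntervalCell) : ℤ := 3 * A.rank w + (-1) ^ C.deg w * a.val

/-- The chains of the product atom system. -/
def tensorChain (s : Bool) (k : ℤ) (w : C.B) : IntervalCell → ((tensor C interval).B →₀ ℤ)
  | .zero => tensorCell C .zero (A.chain s k w)
  | .one => tensorCell C .one (A.chain s k w)
  | .top => tensorCell C .top (A.chain s (k - 1) w) + tensorCell C (endpoint s k) (A.chain s k w)

variable {w x : C.B} {a b : IntervalCell} {s : Bool}

lemma tensor_deg_lt (h : A.tensorRel s w a x b) :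
    pair C x b = pair C w a ∨
      (tensor C interval).deg (pair C x b) < (tensor C interval).deg (pair C w a) := by
  obtain ⟨h1, h2, h3⟩ := h
  rw [tensor_deg, tensor_deg]
  have hab : b = a ∨ b.dim < a.dim := by
    by_cases ha : a = .top
    · subst ha
      rcases h2 rfl with h | h
      · exact Or.inl h
      · right
        rw [h, endpoint]
        split_ifs <;> simp [IntervalCell.dim]
    · exact Or.inl (h3 ha)
  rcases A.deg_lt h1 with h | h
  · subst h
    rcases hab with h | h
    · subst h; exact Or.inl rfl
    · right; omega
  · right
    rcases hab with h' | h'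
    · subst h'; omega
    · omega

/-- The factor `3` makes the rank lexicographic: the interval term lies in `[-1, 1]` and cannot undo
a change in the first factor. If the first factor is unchanged, the sign in the rank cancels the
sign in `endpoint`, so target endpoints always lie above the open cell and source endpoints below
it. -/
lemma tensor_rank_lt (h : A.tensorRel s w a x b) :
    pair C x b = pair C w a ∨
      (if s then A.tensorRank w a < A.tensorRank x b else A.tensorRank x b < A.tensorRank w a) := by
  obtain ⟨h1, h2, h3⟩ := h
  rcases A.rank_lt h1 with h | h
  · subst h
    by_cases ha : a = .top
    · subst ha
      rcases h2 rfl with h | h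
      · subst h; exact Or.inl rfl
      · right
        subst h
        simp only [tensorRank, endpoint, Int.even_coe_nat]
        by_cases he : Even (C.deg x)
        · cases s <;> simp [he, he.neg_one_pow, IntervalCell.val]
        · have ho := Nat.not_even_iff_odd.mp he
          cases s <;> simp [he, ho.neg_one_pow, IntervalCell.val]
    · left; rw [h3 ha]
  · right
    have bound : ∀ (y : C.B) (c : IntervalCell),
        -1 ≤ (-1) ^ C.deg y * c.val ∧ (-1) ^ C.deg y * c.val ≤ 1 := by
      intro y c
      rcases neg_one_pow_eq_or ℤ (C.deg y) with h | h <;> rw [h] <;>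
        cases c <;> simp [IntervalCell.val]
    have e1 := bound w a
    have e2 := bound x b
    simp only [tensorRank]
    cases s <;> simp only [if_true, Bool.false_eq_true, if_false] at h ⊢ <;> omega

lemma tensor_chain_pos {k : ℤ} (hk : ((tensor C interval).deg (pair C x b) : ℤ) = k)
    (h : A.tensorRel s w a x b) : A.tensorChain s k w a (pair C x b) = 1 := by
  obtain ⟨h1, h2, h3⟩ := h
  rw [tensor_deg] at hk
  cases a with
  | zero =>
    rw [h3 (by simp)] at hk ⊢
    rw [tensorChain, tensorCell_apply_same]
    exact A.chain_pos (by simpa [IntervalCell.dim] using hk) h1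
  | one =>
    rw [h3 (by simp)] at hk ⊢
    rw [tensorChain, tensorCell_apply_same]
    exact A.chain_pos (by simpa [IntervalCell.dim] using hk) h1
  | top =>
    rw [tensorChain, Finsupp.add_apply]
    rcases h2 rfl with h | h
    · rw [h] at hk ⊢
      have hk' : (C.deg x : ℤ) + 1 = k := by simpa [IntervalCell.dim] using hk
      rw [tensorCell_apply_same, tensorCell_apply_ne _ (endpoint_ne_top s k).symm, add_zero]
      exact A.chain_pos (by omega) h1
    · have hb : b.dim = 0 := by
        rw [h, endpoint]
        split_ifs <;> rfl
      have hk' : (C.deg x : ℤ) = k := by simpa [hb] using hk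
      subst hk'
      rw [h, tensorCell_apply_same, tensorCell_apply_ne _ (endpoint_ne_top s _), zero_add]
      exact A.chain_pos rfl h1

lemma tensor_chain_zero {k : ℤ}
    (h : ¬ (((tensor C interval).deg (pair C x b) : ℤ) = k ∧ A.tensorRel s w a x b)) :
    A.tensorChain s k w a (pair C x b) = 0 := by
  by_contra hne
  apply h
  rw [tensor_deg]
  have easy : ∀ {a b : IntervalCell} {k' : ℤ},
      tensorCell C a (A.chain s k' w) (pair C x b) ≠ 0 →
        b = a ∧ (C.deg x : ℤ) = k' ∧ A.rel s w x := by
    intro a b k' h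
    by_cases hb : b = a
    · subst hb
      rw [tensorCell_apply_same] at h
      exact ⟨rfl, A.chain_ne_zero h⟩
    · exact absurd (tensorCell_apply_ne C hb _ x) h
  cases a with
  | zero =>
    obtain ⟨rfl, h1, h2⟩ := easy hne
    exact ⟨by simpa [IntervalCell.dim] using h1, h2, by simp, by simp⟩
  | one =>
    obtain ⟨rfl, h1, h2⟩ := easy hne
    exact ⟨by simpa [IntervalCell.dim] using h1, h2, by simp, by simp⟩
  | top =>
    rw [tensorChain, Finsupp.add_apply] at hne
    by_cases h' : tensorCell C .top (A.chain s (k - 1) w) (pair C x b) = 0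
    · rw [h', zero_add] at hne
      obtain ⟨rfl, rfl, h2⟩ := easy hne
      refine ⟨?_, h2, by simp, by simp⟩
      rw [endpoint]
      split_ifs <;> simp [IntervalCell.dim]
    · obtain ⟨rfl, h1, h2⟩ := easy h'
      refine ⟨?_, h2, by simp, by simp⟩
      simp only [IntervalCell.dim]
      push_cast
      omega

lemma tensor_bd_chain (s : Bool) (k : ℤ) (w : C.B) (a : IntervalCell) :
    (tensor C interval).bd (A.tensorChain s k w a) =
      A.tensorChain true (k - 1) w a - A.tensorChain false (k - 1) w a := by
  cases a with
  | zero => simp only [tensorChain, bd_tensorCell_zero, A.bd_chain, map_sub]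
  | one => simp only [tensorChain, bd_tensorCell_one, A.bd_chain, map_sub]
  | top =>
    have hs : degreeSign C (A.chain s (k - 1) w) =
        if Even (k - 1) then A.chain s (k - 1) w else -A.chain s (k - 1) w :=
      degreeSign_of_homogeneous C fun b hb => (A.chain_ne_zero hb).1
    have he : Even (k - 1) ↔ ¬ Even k := Int.even_sub_one
    simp only [tensorChain, map_add, bd_tensorCell_top, A.bd_chain, map_sub, hs, endpoint, he]
    -- The chain `A.chain s (k - 1) w` placed at `endpoint s k` arises from both summands with
    -- opposite signs. What survives is the target at one endpoint minus the source at the other.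
    by_cases hk : Even k <;> cases s <;>
      simp [hk, bd_tensorCell_zero, bd_tensorCell_one, A.bd_chain] <;> abel

lemma tensor_aug_chain (s : Bool) (w : C.B) (a : IntervalCell) :
    (tensor C interval).aug (A.tensorChain s 0 w a) = 1 := by
  cases a with
  | zero => rw [tensorChain, aug_tensorCell _ (by simp), A.aug_chain]
  | one => rw [tensorChain, aug_tensorCell _ (by simp), A.aug_chain]
  | top =>
    rw [tensorChain, A.chain_eq_zero (by simp), map_zero, zero_add,
      aug_tensorCell _ (endpoint_ne_top s 0), A.aug_chain]

/-- The atoms of the product of a complex with the interval. -/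
def tensorInterval : AtomSystem (tensor C interval) where
  rel s p q := A.tensorRel s p.1 p.2 q.1 q.2
  rank p := A.tensorRank p.1 p.2
  chain s k p := A.tensorChain s k p.1 p.2
  rel_refl s w := ⟨A.rel_refl s w.1, Or.inl, fun _ => rfl⟩
  deg_lt h := A.tensor_deg_lt h
  rank_lt h := A.tensor_rank_lt h
  chain_pos hk h := A.tensor_chain_pos hk h
  chain_zero h := A.tensor_chain_zero h
  bd_chain s k p := A.tensor_bd_chain s k p.1 p.2
  aug_chain s p := A.tensor_aug_chain s p.1 p.2

/-- The atoms of the point. -/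
def unit : AtomSystem BasedChainData.unit where
  rel _ _ _ := True
  rank _ := 0
  chain _ k w := if k = 0 then Finsupp.single w 1 else 0
  rel_refl _ _ := trivial
  deg_lt _ := Or.inl rfl
  rank_lt _ := Or.inl rfl
  chain_pos := by
    intro s k w x h _
    have hk : k = 0 := by rw [← h]; rfl
    rw [if_pos hk]
    exact Finsupp.single_eq_same
  chain_zero := by
    intro s k w x h
    rw [if_neg]
    · rfl
    · rintro rfl
      exact h ⟨rfl, trivial⟩
  bd_chain s k w := by
    rw [sub_self]; rfl
  aug_chain s w := by
    rw [if_pos rfl, aug, Finsupp.linearCombination_single]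
    simp [BasedChainData.unit]

/-- The atoms of the cubical oriental. -/
def cubical : ∀ d : ℕ, AtomSystem (cubicalOriental d)
  | 0 => unit
  | d + 1 => (cubical d).tensorInterval

end AtomSystem

/-! ### Truncations of complexes with known atoms -/

/-- The complex `C` embeds in degrees less than `d` as a subcomplex of `Q`, and each basis element
of `C` corresponds to one of `Q`, those of degree at least `d` being given degree `d` and the
difference of their `d - 1`-dimensional target and source as boundary. -/
structure IsTruncation {Q : BasedChainData} (A : AtomSystem Q) (d : ℕ) (C : BasedChainData)
    (f : C.B → Q.B) : Prop where
  injective : Function.Injective f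
  deg_eq : ∀ b, C.deg b = min d (Q.deg (f b))
  map_bd_single : ∀ b, (C.bd (Finsupp.single b 1)).mapDomain f =
    A.chain true ((C.deg b : ℤ) - 1) (f b) - A.chain false ((C.deg b : ℤ) - 1) (f b)

lemma AtomSystem.aug_chain_of_ne {Q : BasedChainData} (A : AtomSystem Q) {s : Bool} {k : ℤ}
    {w : Q.B} (hk : k ≠ 0) : Q.aug (A.chain s k w) = 0 := by
  rw [aug, Finsupp.linearCombination_apply]
  refine Finset.sum_eq_zero fun b hb => ?_
  have h := (A.chain_ne_zero (Finsupp.mem_support_iff.mp hb)).1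
  have h0 : Q.deg b ≠ 0 := by omega
  simp [h0]

namespace IsTruncation

variable {Q : BasedChainData} {A : AtomSystem Q} {d : ℕ} {C : BasedChainData} {f : C.B → Q.B}
  (T : IsTruncation A d C f)
include T

lemma deg_le (b : C.B) : C.deg b ≤ Q.deg (f b) := by
  rw [T.deg_eq]; exact min_le_right _ _

lemma deg_le_dim (b : C.B) : C.deg b ≤ d := by
  rw [T.deg_eq]; exact min_le_left _ _

lemma deg_eq_of_lt {b : C.B} (h : C.deg b < d) : Q.deg (f b) = C.deg b := by
  have := T.deg_eq b
  omega

lemma deg_eq_of_map_lt {b : C.B} (h : Q.deg (f b) < d) : C.deg b = Q.deg (f b) := by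
  have := T.deg_eq b
  omega

lemma map_apply (c : C.B →₀ ℤ) (b : C.B) : c.mapDomain f (f b) = c b :=
  Finsupp.mapDomain_apply T.injective c b

lemma bd_single_apply (b b' : C.B) : C.bd (Finsupp.single b 1) b' =
    A.chain true ((C.deg b : ℤ) - 1) (f b) (f b') -
      A.chain false ((C.deg b : ℤ) - 1) (f b) (f b') := by
  rw [← T.map_apply, T.map_bd_single, Finsupp.sub_apply]

lemma bd_deg (b b' : C.B) (h : C.bd (Finsupp.single b 1) b' ≠ 0) : C.deg b' + 1 = C.deg b := by
  rw [T.bd_single_apply] at h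
  have hd : (Q.deg (f b') : ℤ) = C.deg b - 1 := by
    by_cases h1 : A.chain true ((C.deg b : ℤ) - 1) (f b) (f b') = 0
    · rw [h1, zero_sub, neg_ne_zero] at h
      exact (A.chain_ne_zero h).1
    · exact (A.chain_ne_zero h1).1
  have h2 := T.deg_le_dim b
  rw [T.deg_eq_of_map_lt (by omega)]
  omega

/-- Below degree `d` the map `f` preserves degrees, so the prescribed boundary is the boundary of
the image. This fails for a generator whose degree was lowered to `d`, hence the restriction on `c`.
-/
lemma map_bd {c : C.B →₀ ℤ} (hc : ∀ b, c b ≠ 0 → C.deg b < d) :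
    (C.bd c).mapDomain f = Q.bd (c.mapDomain f) := by
  induction c using Finsupp.induction with
  | zero => simp
  | single_add b m c hb hm ih =>
    have hcb : c b = 0 := Finsupp.notMem_support_iff.mp hb
    have h1 : C.deg b < d := hc b (by simp [hcb, hm])
    have h2 : ∀ b', c b' ≠ 0 → C.deg b' < d := by
      intro b' hb'
      apply hc
      have : b' ≠ b := by rintro rfl; exact hb' hcb
      simp [Finsupp.single_eq_of_ne this, hb']
    rw [map_add, Finsupp.mapDomain_add, ih h2, Finsupp.mapDomain_add, map_add, single_eq_smul,
      map_smul, Finsupp.mapDomain_smul, Finsupp.mapDomain_smul, map_smul, Finsupp.mapDomain_single,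
      T.map_bd_single, A.bd_single, T.deg_eq_of_lt h1]

lemma bd_bd (c : C.B →₀ ℤ) : C.bd (C.bd c) = 0 := by
  induction c using Finsupp.induction_linear with
  | zero => simp
  | add x y hx hy => rw [map_add, map_add, hx, hy, add_zero]
  | single b m =>
    rw [single_eq_smul, map_smul, map_smul]
    suffices h : C.bd (C.bd (Finsupp.single b 1)) = 0 by rw [h, smul_zero]
    apply Finsupp.mapDomain_injective T.injective
    -- Target and source in the same dimension are parallel: `bd_chain` gives them equal boundaries,
    -- even when `b` has been truncated.
    rw [T.map_bd, T.map_bd_single, map_sub, A.bd_chain, A.bd_chain, sub_self,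
      Finsupp.mapDomain_zero]
    intro b' hb'
    have h1 := T.bd_deg b b' hb'
    have h2 := T.deg_le_dim b
    omega

/-- For `d = 0` every generator is placed in degree zero, while an image of positive degree has
augmentation zero; hence `hd`. -/
lemma aug_map (hd : d ≠ 0) (c : C.B →₀ ℤ) : Q.aug (c.mapDomain f) = C.aug c := by
  rw [aug, Finsupp.linearCombination_mapDomain, aug]
  congr 2
  funext b
  have h := T.deg_eq b
  have : Q.deg (f b) = 0 ↔ C.deg b = 0 := by omega
  simp [this]

lemma aug_bd (c : C.B →₀ ℤ) : C.aug (C.bd c) = 0 := by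
  induction c using Finsupp.induction_linear with
  | zero => simp
  | add x y hx hy => rw [map_add, map_add, hx, hy, add_zero]
  | single b m =>
    rw [single_eq_smul, map_smul, map_smul]
    suffices h : C.aug (C.bd (Finsupp.single b 1)) = 0 by rw [h, smul_zero]
    rcases Nat.eq_zero_or_pos (C.deg b) with h0 | h0
    · have : C.bd (Finsupp.single b 1) = 0 := by
        ext b'
        by_contra h
        have := T.bd_deg b b' h
        omega
      rw [this, map_zero]
    · have h1 := T.deg_le_dim b
      rw [← T.aug_map (by omega), T.map_bd_single, map_sub]
      rcases Nat.lt_or_ge 1 (C.deg b) with h2 | h2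
      · rw [A.aug_chain_of_ne (by omega), A.aug_chain_of_ne (by omega), sub_self]
      · have : (C.deg b : ℤ) - 1 = 0 := by omega
        rw [this, A.aug_chain, A.aug_chain, sub_self]

lemma isComplex : C.IsComplex := ⟨T.bd_deg, T.bd_bd, T.aug_bd⟩

lemma map_bdPart {c : C.B →₀ ℤ} {k : ℤ} {w : Q.B} (hk : k < Q.deg w)
    (h : (C.bd c).mapDomain f = A.chain true k w - A.chain false k w) (s : Bool) :
    (C.bdPart s c).mapDomain f = A.chain s k w := by
  ext y
  have hy := DFunLike.congr_fun h y
  rw [Finsupp.sub_apply] at hy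
  have n1 := A.chain_nonneg true k w y
  have n2 := A.chain_nonneg false k w y
  have hdis := A.chain_disjoint hk y
  by_cases hr : y ∈ Set.range f
  · obtain ⟨b, rfl⟩ := hr
    rw [T.map_apply] at hy ⊢
    cases s
    · simp only [bdPart, Bool.false_eq_true, if_false, Finsupp.sup_apply, Finsupp.neg_apply,
        Finsupp.coe_zero, Pi.zero_apply, hy]
      omega
    · simp only [bdPart, if_true, Finsupp.sup_apply, Finsupp.coe_zero, Pi.zero_apply, hy]
      omega
  · rw [Finsupp.mapDomain_of_notMem_range _ _ hr] at hy ⊢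
    cases s <;> omega

lemma map_bdPart_single (s : Bool) (b : C.B) :
    (C.bdPart s (Finsupp.single b 1)).mapDomain f = A.chain s ((C.deg b : ℤ) - 1) (f b) := by
  have := T.deg_le b
  exact T.map_bdPart (by omega) (T.map_bd_single b) s

/-- At least one iteration is needed: for a truncated `b`, the chain of `f b` in degree `C.deg b` is
not the generator `f b` itself. -/
lemma map_iterate (s : Bool) (b : C.B) (m : ℕ) (hm : m + 1 ≤ C.deg b) :
    ((C.bdPart s)^[m + 1] (Finsupp.single b 1)).mapDomain f =
      A.chain s ((C.deg b : ℤ) - (m + 1 : ℕ)) (f b) := by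
  induction m with
  | zero => simpa using T.map_bdPart_single s b
  | succ m ih =>
    have ih := ih (by omega)
    have h1 := T.deg_le b
    have h2 := T.deg_le_dim b
    rw [Function.iterate_succ_apply']
    apply T.map_bdPart (by omega)
    rw [T.map_bd, ih, A.bd_chain]
    · congr 2 <;> push_cast <;> ring
    · intro b' hb'
      rw [← T.map_apply, ih] at hb'
      have h3 := (A.chain_ne_zero hb').1
      rw [T.deg_eq_of_map_lt] <;> omega

lemma map_atom (s : Bool) (b : C.B) {k : ℕ} (hk : k < C.deg b) :
    (C.atom s b k).mapDomain f = A.chain s k (f b) := by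
  obtain ⟨m, hm⟩ : ∃ m, C.deg b - k = m + 1 := ⟨C.deg b - k - 1, by omega⟩
  rw [atom, hm, T.map_iterate s b m (by omega), ← hm, Nat.cast_sub hk.le, sub_sub_cancel]

lemma isUnital : C.IsUnital := by
  intro s b
  rcases Nat.eq_zero_or_pos (C.deg b) with h0 | h0
  · rw [atom, h0, Nat.sub_self, Function.iterate_zero, id, aug, Finsupp.linearCombination_single]
    simp [h0]
  · have h1 := T.deg_le_dim b
    rw [← T.aug_map (by omega), T.map_atom s b h0]
    exact A.aug_chain s (f b)

lemma rank_lt_of_chain {b b' : C.B} {k : ℕ} (hk : k < C.deg b) :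
    (A.chain true k (f b) (f b') ≠ 0 → A.rank (f b) < A.rank (f b')) ∧
      (A.chain false k (f b) (f b') ≠ 0 → A.rank (f b') < A.rank (f b)) := by
  have hne : ∀ {s}, A.chain s k (f b) (f b') ≠ 0 → f b' ≠ f b := by
    intro s h he
    have h1 := (A.chain_ne_zero h).1
    have h2 := T.deg_le b
    rw [he] at h1
    omega
  constructor <;> intro h
  · simpa using (A.rank_lt (A.chain_ne_zero h).2).resolve_left (hne h)
  · simpa using (A.rank_lt (A.chain_ne_zero h).2).resolve_left (hne h)

lemma rank_lt_of_ltN {b b' : C.B} (h : C.ltN b b') : A.rank (f b) < A.rank (f b') := by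
  have aux : ∀ {s} {x y : C.B}, C.bdPart s (Finsupp.single x 1) y ≠ 0 →
      ∃ k : ℕ, k < C.deg x ∧ A.chain s k (f x) (f y) ≠ 0 := by
    intro s x y h
    rw [← T.map_apply, T.map_bdPart_single] at h
    have h1 := (A.chain_ne_zero h).1
    refine ⟨Q.deg (f y), by omega, ?_⟩
    rwa [h1]
  rcases h with h | h
  · obtain ⟨k, hk, h⟩ := aux h
    exact (T.rank_lt_of_chain hk).2 h
  · obtain ⟨k, hk, h⟩ := aux h
    exact (T.rank_lt_of_chain hk).1 h

/-- The rank rises from `b` to the common cell `e` of its target, and again from `e` to `b'`. -/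
lemma rank_lt_of_ltAt {b b' : C.B} {k : ℕ} (h : C.ltAt k b b') :
    A.rank (f b) < A.rank (f b') := by
  obtain ⟨hb, hb', e, h1, h2⟩ := h
  rw [← T.map_apply, T.map_atom _ _ hb] at h1
  rw [← T.map_apply, T.map_atom _ _ hb'] at h2
  exact ((T.rank_lt_of_chain hb).1 h1).trans ((T.rank_lt_of_chain hb').2 h2)

omit T in
lemma antisymm_of_rank {B : Type} {r : B → B → Prop} {g : B → ℤ}
    (h : ∀ b b', r b b' → g b < g b') (b b' : B) (h1 : Relation.TransGen r b b')
    (h2 : Relation.TransGen r b' b) : b = b' := by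
  have key : ∀ {x y}, Relation.TransGen r x y → g x < g y := by
    intro x y hxy
    induction hxy with
    | single h' => exact h _ _ h'
    | tail _ h' ih => exact ih.trans (h _ _ h')
  exact absurd (key h1) (key h2).not_gt

/-- A truncation of a complex with known atoms is a strong Steiner diagram. -/
theorem isStrongSteiner : C.IsStrongSteiner :=
  ⟨⟨T.isComplex, T.isUnital,
    fun _ => antisymm_of_rank (g := A.rank ∘ f) fun _ _ => T.rank_lt_of_ltAt⟩,
    antisymm_of_rank (g := A.rank ∘ f) fun _ _ => T.rank_lt_of_ltN⟩

/-- If `f` is bijective and no truncation takes place, then `C` is isomorphic to `Q`. -/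
theorem isomorphic (hf : Function.Bijective f) (hd : ∀ b, Q.deg (f b) ≤ d) :
    C.Isomorphic Q := by
  have hdeg : ∀ b, C.deg b = Q.deg (f b) := fun b => by
    rw [T.deg_eq, min_eq_right (hd b)]
  let e : C.B ≃ Q.B := Equiv.ofBijective f hf
  have he : ∀ b, e b = f b := fun _ => rfl
  have hbd : ∀ c : C.B →₀ ℤ, (C.bd c).mapDomain f = Q.bd (c.mapDomain f) := by
    intro c
    induction c using Finsupp.induction_linear with
    | zero => simp
    | add x y hx hy => simp only [map_add, Finsupp.mapDomain_add, hx, hy]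
    | single b m =>
      rw [single_eq_smul, map_smul, Finsupp.mapDomain_smul, Finsupp.mapDomain_smul, map_smul,
        Finsupp.mapDomain_single, T.map_bd_single, A.bd_single, hdeg]
  have haug : ∀ c : C.B →₀ ℤ, Q.aug (c.mapDomain f) = C.aug c := by
    intro c
    rw [aug, Finsupp.linearCombination_mapDomain, aug]
    congr 2
    funext b
    simp [hdeg]
  have hinv : ∀ c : Q.B →₀ ℤ, (c.mapDomain e.symm).mapDomain f = c := by
    intro c
    rw [← Finsupp.mapDomain_comp]
    have : f ∘ e.symm = id := by
      funext y; exact e.apply_symm_apply y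
    rw [this, Finsupp.mapDomain_id]
  have hinv' : ∀ c : C.B →₀ ℤ, (c.mapDomain f).mapDomain e.symm = c := by
    intro c
    rw [← Finsupp.mapDomain_comp]
    have : e.symm ∘ f = id := by
      funext y; exact e.symm_apply_apply y
    rw [this, Finsupp.mapDomain_id]
  have single_ne : ∀ {B : Type} {x y : B}, Finsupp.single x (1 : ℤ) y ≠ 0 → y = x := by
    intro B x y h
    by_contra h'
    exact h (Finsupp.single_eq_of_ne h')
  refine ⟨⟨Finsupp.lmapDomain ℤ ℤ f, ?_, hbd, haug, ?_⟩,
    ⟨Finsupp.lmapDomain ℤ ℤ e.symm, ?_, ?_, ?_, ?_⟩, ?_, ?_⟩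
  · intro b b' h
    rw [Finsupp.lmapDomain_apply, Finsupp.mapDomain_single] at h
    rw [single_ne h, hdeg]
  · intro b
    rw [Finsupp.lmapDomain_apply, Finsupp.mapDomain_single]
    exact Finsupp.single_nonneg.mpr zero_le_one
  · intro b b' h
    rw [Finsupp.lmapDomain_apply, Finsupp.mapDomain_single] at h
    rw [single_ne h, hdeg, ← he, e.apply_symm_apply]
  · intro c
    apply Finsupp.mapDomain_injective T.injective
    simp only [Finsupp.lmapDomain_apply]
    rw [hinv, hbd, hinv]
  · intro c
    rw [Finsupp.lmapDomain_apply, ← haug, hinv]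
  · intro b
    rw [Finsupp.lmapDomain_apply, Finsupp.mapDomain_single]
    exact Finsupp.single_nonneg.mpr zero_le_one
  · exact LinearMap.ext hinv'
  · exact LinearMap.ext hinv

end IsTruncation

/-! ### Sign vectors as cells of the cube -/

/-- The cell of the interval with a given sign, the open cell having sign zero. -/
def IntervalCell.ofSign : SignType → IntervalCell
  | 0 => .top
  | 1 => .one
  | -1 => .zero

lemma IntervalCell.ofSign_bijective : Function.Bijective IntervalCell.ofSign := by
  constructor
  · intro a b h
    cases a <;> cases b <;> first | rfl | exact absurd h (by simp [IntervalCell.ofSign])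
  · intro c
    cases c
    exacts [⟨-1, rfl⟩, ⟨1, rfl⟩, ⟨0, rfl⟩]

lemma IntervalCell.dim_ofSign (a : SignType) :
    (IntervalCell.ofSign a).dim = if a = 0 then 1 else 0 := by
  cases a <;> rfl

lemma IntervalCell.ofSign_eq_top {a : SignType} : IntervalCell.ofSign a = .top ↔ a = 0 := by
  cases a <;> simp [IntervalCell.ofSign]

/-- The sign `1` or `-1` that corresponds to a Boolean. -/
def boolSign (s : Bool) : SignType := if s then 1 else -1

lemma endpoint_eq (s : Bool) (k : ℕ) :
    endpoint s k = IntervalCell.ofSign (boolSign s * (-1) ^ k) := by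
  unfold endpoint boolSign
  simp only [Int.even_coe_nat]
  by_cases he : Even k
  · rw [he.neg_one_pow]
    cases s <;> simp [he, IntervalCell.ofSign]
  · rw [(Nat.not_even_iff_odd.mp he).neg_one_pow]
    cases s <;> simp [he, IntervalCell.ofSign]

/-- The cell of the cube with a given sign vector. -/
def word : ∀ {n : ℕ}, (Fin n → SignType) → (cubicalOriental n).B
  | 0, _ => ()
  | _ + 1, X => pair _ (word (Fin.tail X)) (IntervalCell.ofSign (X 0))

lemma word_injective {n : ℕ} : Function.Injective (word (n := n)) := by
  induction n with
  | zero => intro X Y _; exact Subsingleton.elim X Y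
  | succ n ih =>
    intro X Y h
    obtain ⟨h1, h2⟩ := pair_injective _ h
    rw [← Fin.cons_self_tail X, ← Fin.cons_self_tail Y, ih h1, IntervalCell.ofSign_bijective.1 h2]

lemma word_surjective {n : ℕ} : Function.Surjective (word (n := n)) := by
  induction n with
  | zero => intro _; exact ⟨Fin.elim0, rfl⟩
  | succ n ih =>
    intro p
    obtain ⟨w, a, rfl⟩ := exists_pair _ p
    obtain ⟨X, rfl⟩ := ih w
    obtain ⟨x, rfl⟩ := IntervalCell.ofSign_bijective.2 a
    exact ⟨Fin.cons x X, rfl⟩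

/-- The number of zeros of a sign vector. -/
def zeroCount {n : ℕ} (X : Fin n → SignType) : ℕ := ∑ i, if X i = 0 then 1 else 0

lemma zeroCount_eq_card {n : ℕ} (X : Fin n → SignType) :
    zeroCount X = Fintype.card {i // X i = 0} := by
  rw [Fintype.card_subtype, zeroCount, Finset.card_filter]

lemma deg_word {n : ℕ} (X : Fin n → SignType) : (cubicalOriental n).deg (word X) = zeroCount X := by
  induction n with
  | zero => rfl
  | succ n ih =>
    rw [zeroCount, Fin.sum_univ_succ, add_comm (ite _ _ _)]
    refine (tensor_deg _ _ _).trans ?_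
    rw [ih, IntervalCell.dim_ofSign]
    rfl

/-- The product of the differences `a - t j`, for `j` running over the zeros of `Y`. -/
def nodal {n : ℕ} (t : Fin n → ℝ) (Y : Fin n → SignType) (a : ℝ) : ℝ :=
  ∏ j, if Y j = 0 then a - t j else 1

lemma sign_prod {ι : Type*} (s : Finset ι) (f : ι → ℝ) :
    SignType.sign (∏ i ∈ s, f i) = ∏ i ∈ s, SignType.sign (f i) :=
  map_prod (signHom (α := ℝ)) f s

lemma sign_nodal_of_lt {n : ℕ} {t : Fin n → ℝ} (Y : Fin n → SignType) {a : ℝ}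
    (ha : ∀ i, a < t i) : SignType.sign (nodal t Y a) = (-1) ^ zeroCount Y := by
  rw [nodal, sign_prod, zeroCount, ← Finset.prod_pow_eq_pow_sum]
  refine Finset.prod_congr rfl fun i _ => ?_
  split_ifs
  · rw [pow_one, sign_neg (sub_neg.mpr (ha i))]
  · rw [sign_one, pow_zero]

/-- `Y` is a target (`s = 1`) or source (`s = -1`) of `X`, in a complex where the orientations are
governed by the signs of the nodal polynomials of `Y`, up to `ρ`. -/
def SignRel {n : ℕ} (t : Fin n → ℝ) (ρ : ℕ → ℝ) (s : SignType) (X Y : Fin n → SignType) : Prop :=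
  ∀ i, (X i ≠ 0 → Y i = X i) ∧
    (X i = 0 → Y i = 0 ∨ Y i = s * SignType.sign (ρ (zeroCount Y) * nodal t Y (t i)))

/-- In `word`, coordinate `0` is the last tensor factor, so the Koszul exponent at `i` counts the
zeros of `Y` after `i`. As `t` increases, these are the negative factors of the nodal polynomial at
`t i`. -/
lemma cubical_rel_word {n : ℕ} {t : Fin n → ℝ} (ht : StrictMono t) (s : Bool)
    (X Y : Fin n → SignType) : (AtomSystem.cubical n).rel s (word X) (word Y) ↔
      SignRel t (fun _ => 1) (boolSign s) X Y := by
  induction n with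
  | zero => exact ⟨fun _ i => i.elim0, fun _ => trivial⟩
  | succ n ih =>
    have ht' : StrictMono (Fin.tail t) := fun i j h => ht (Fin.succ_lt_succ_iff.mpr h)
    have h1 : (AtomSystem.cubical (n + 1)).rel s (word X) (word Y) ↔
        (AtomSystem.cubical n).rel s (word (Fin.tail X)) (word (Fin.tail Y)) ∧
        (IntervalCell.ofSign (X 0) = .top → IntervalCell.ofSign (Y 0) = .top ∨
          IntervalCell.ofSign (Y 0) = endpoint s ((cubicalOriental n).deg (word (Fin.tail Y)))) ∧
        (IntervalCell.ofSign (X 0) ≠ .top →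
          IntervalCell.ofSign (Y 0) = IntervalCell.ofSign (X 0)) := Iff.rfl
    have h2 : ∀ i : Fin n, SignType.sign (nodal t Y (t i.succ)) =
        SignType.sign (nodal (Fin.tail t) (Fin.tail Y) (Fin.tail t i)) := by
      intro i
      rw [nodal, Fin.prod_univ_succ, sign_mul]
      have : SignType.sign (if Y 0 = 0 then t i.succ - t 0 else 1) = 1 := by
        apply sign_pos
        split_ifs
        · exact sub_pos.mpr (ht (Fin.succ_pos i))
        · exact one_pos
      rw [this, one_mul]
      rfl
    have h3 : Y 0 ≠ 0 → SignType.sign (nodal t Y (t 0)) = (-1) ^ zeroCount (Fin.tail Y) := by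
      intro h
      rw [nodal, Fin.prod_univ_succ, if_neg h, one_mul]
      exact sign_nodal_of_lt (t := Fin.tail t) (Fin.tail Y) fun i => ht (Fin.succ_pos i)
    rw [h1, ih ht', endpoint_eq, deg_word, SignRel, SignRel, Fin.forall_fin_succ,
      IntervalCell.ofSign_eq_top, IntervalCell.ofSign_eq_top, ne_eq, IntervalCell.ofSign_eq_top,
      IntervalCell.ofSign_bijective.1.eq_iff, IntervalCell.ofSign_bijective.1.eq_iff, and_comm]
    simp only [one_mul, h2]
    refine and_congr ?_ Iff.rfl
    by_cases hY : Y 0 = 0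
    · simp only [hY, true_or, implies_true, true_and, and_true]
    · rw [h3 hY]
      exact and_comm

lemma zeroCount_rev {n : ℕ} (Y : Fin n → SignType) : zeroCount (Y ∘ Fin.rev) = zeroCount Y :=
  Equiv.sum_comp Fin.revPerm fun i => if Y i = 0 then 1 else 0

lemma nodal_neg_rev {n : ℕ} (t : Fin n → ℝ) (Y : Fin n → SignType) (a : ℝ) :
    nodal (fun i => -t i.rev) (Y ∘ Fin.rev) (-a) = (-1) ^ zeroCount Y * nodal t Y a := by
  have h := Equiv.prod_comp Fin.revPerm fun i => if Y i = 0 then -a - -t i else 1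
  simp only [nodal, Function.comp_apply, Fin.revPerm_apply] at h ⊢
  rw [h, zeroCount, ← Finset.prod_pow_eq_pow_sum, ← Finset.prod_mul_distrib]
  refine Finset.prod_congr rfl fun i _ => ?_
  split_ifs <;> ring

/-- Replacing `t` by its reversed negative reverses the tensor factors and negates each factor of
the nodal polynomial. The resulting sign `(-1) ^ zeroCount Y` is the scale of the alternating frame.
-/
lemma cubical_rel_word_rev {n : ℕ} {t : Fin n → ℝ} (ht : StrictMono t) (s : Bool)
    (X Y : Fin n → SignType) :
    (AtomSystem.cubical n).rel s (word (X ∘ Fin.rev)) (word (Y ∘ Fin.rev)) ↔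
      SignRel t (fun m => (-1) ^ m) (boolSign s) X Y := by
  have ht' : StrictMono fun i : Fin n => -t i.rev :=
    fun i j h => neg_lt_neg (ht (Fin.rev_lt_rev.mpr h))
  rw [cubical_rel_word ht', SignRel, SignRel, ← Fin.revPerm.forall_congr_right]
  refine forall_congr' fun i => ?_
  simp only [Function.comp_apply, Fin.revPerm_apply, Fin.rev_rev, nodal_neg_rev, one_mul]

end BasedChainData

namespace FramedPolytope

open BasedChainData

variable {d n : ℕ}

/-! ### Faces of cyclic zonotopes -/

/-- The face of the unit cube with a given sign vector. -/
def InBox (X : Fin n → SignType) (x : Fin n → ℝ) : Prop :=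
  ∀ i, 0 ≤ x i ∧ x i ≤ 1 ∧ (X i = 1 → x i = 1) ∧ (X i = -1 → x i = 0)

/-- The image in the cyclic zonotope of the face of the unit cube with a given sign vector. -/
def cell (d : ℕ) (t : Fin n → ℝ) (X : Fin n → SignType) : Set (Fin d → ℝ) :=
  {y | ∃ x, InBox X x ∧ y = ∑ i, x i • veronese d (t i)}

/-- The sign vector of a functional on the generators of the cyclic zonotope. -/
def signOf (t : Fin n → ℝ) (φ : Module.Dual ℝ (Fin d → ℝ)) : Fin n → SignType :=
  fun i => SignType.sign (φ (veronese d (t i)))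

/-- The composition of sign vectors. -/
def compose (X Y : Fin n → SignType) : Fin n → SignType := fun i => if X i = 0 then Y i else X i

lemma compose_eq_right {X Y : Fin n → SignType} (h : ∀ i, X i ≠ 0 → Y i = X i) :
    compose X Y = Y := by
  funext i
  unfold compose
  split_ifs with hi
  · rfl
  · exact (h i hi).symm

lemma cyclicZonotope_eq_cell (t : Fin n → ℝ) : cyclicZonotope d t = cell d t 0 := by
  ext y
  rw [cyclicZonotope, Set.mem_fintype_sum]
  constructor
  · rintro ⟨g, hg, rfl⟩
    have : ∀ i, ∃ a : ℝ, (0 ≤ a ∧ a ≤ 1) ∧ g i = a • veronese d (t i) := by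
      intro i
      have := hg i
      rw [segment_eq_image] at this
      obtain ⟨a, ha, h⟩ := this
      exact ⟨a, ha, by simp [← h]⟩
    choose x hx hgx using this
    exact ⟨x, fun i => ⟨(hx i).1, (hx i).2, by simp, by simp⟩, by simp_rw [hgx]⟩
  · rintro ⟨x, hx, rfl⟩
    refine ⟨fun i => x i • veronese d (t i), fun i => ?_, rfl⟩
    rw [segment_eq_image]
    exact ⟨x i, ⟨(hx i).1, (hx i).2.1⟩, by simp⟩

lemma isPolytope_cyclicZonotope (t : Fin n → ℝ) : IsPolytope (cyclicZonotope d t) := by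
  classical
  refine ⟨∑ i : Fin n, {0, veronese d (t i)}, ?_⟩
  rw [Finset.coe_sum, convexHull_sum, cyclicZonotope]
  simp only [Finset.coe_insert, Finset.coe_singleton, convexHull_pair]

lemma exists_inBox (X : Fin n → SignType) : ∃ x, InBox X x := by
  refine ⟨fun i => if X i = 1 then 1 else 0, fun i => ⟨?_, ?_, ?_, ?_⟩⟩
  · dsimp only; split_ifs <;> simp
  · dsimp only; split_ifs <;> simp
  · intro h; simp [h]
  · intro h; simp [h]

lemma InBox.mono {X Y : Fin n → SignType} {x : Fin n → ℝ} (h : ∀ i, X i ≠ 0 → Y i = X i)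
    (hx : InBox Y x) : InBox X x := by
  intro i
  refine ⟨(hx i).1, (hx i).2.1, fun hi => (hx i).2.2.1 ?_, fun hi => (hx i).2.2.2 ?_⟩
  · rw [h i (by simp [hi]), hi]
  · rw [h i (by simp [hi]), hi]

lemma cell_nonempty (t : Fin n → ℝ) (X : Fin n → SignType) : (cell d t X).Nonempty := by
  obtain ⟨x, hx⟩ := exists_inBox X
  exact ⟨_, x, hx, rfl⟩

lemma map_point (t : Fin n → ℝ) (φ : Module.Dual ℝ (Fin d → ℝ)) (x : Fin n → ℝ) :
    φ (∑ i, x i • veronese d (t i)) = ∑ i, x i * φ (veronese d (t i)) := by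
  rw [map_sum]
  simp_rw [map_smul, smul_eq_mul]

/-! ### Maximizing functionals over cells -/

section Maximize

variable {t : Fin n → ℝ} {φ : Module.Dual ℝ (Fin d → ℝ)} {X : Fin n → SignType}
  {x x' : Fin n → ℝ}

lemma compose_of_ne_zero (X Y : Fin n → SignType) : ∀ i, X i ≠ 0 → compose X Y i = X i := by
  intro i hi
  simp [compose, hi]

lemma inBox_mul_le (hx : InBox (compose X (signOf t φ)) x) (hx' : InBox X x') (i : Fin n) :
    x' i * φ (veronese d (t i)) ≤ x i * φ (veronese d (t i)) := by
  have hX := hx.mono (compose_of_ne_zero X _)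
  rcases h : X i with _ | _ | _
  · have hc : compose X (signOf t φ) i = signOf t φ i := if_pos h
    rcases lt_trichotomy (φ (veronese d (t i))) 0 with hs | hs | hs
    · have h0 : x i = 0 := (hx i).2.2.2 (by rw [hc]; exact sign_neg hs)
      rw [h0, zero_mul]
      exact mul_nonpos_of_nonneg_of_nonpos (hx' i).1 hs.le
    · simp [hs]
    · have h0 : x i = 1 := (hx i).2.2.1 (by rw [hc]; exact sign_pos hs)
      rw [h0]
      exact mul_le_mul_of_nonneg_right (hx' i).2.1 hs.le
  · rw [(hX i).2.2.2 h, (hx' i).2.2.2 h]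
  · rw [(hX i).2.2.1 h, (hx' i).2.2.1 h]

lemma inBox_of_mul_eq (hx : InBox (compose X (signOf t φ)) x) (hx' : InBox X x')
    (h : ∀ i, x' i * φ (veronese d (t i)) = x i * φ (veronese d (t i))) :
    InBox (compose X (signOf t φ)) x' := by
  intro i
  by_cases hi : X i = 0
  · have hc : compose X (signOf t φ) i = signOf t φ i := if_pos hi
    have key : signOf t φ i ≠ 0 → x' i = x i := fun hne =>
      mul_right_cancel₀ (sign_ne_zero.mp hne) (h i)
    refine ⟨(hx' i).1, (hx' i).2.1, fun h1 => ?_, fun h1 => ?_⟩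
    · rw [key (by rw [← hc, h1]; decide)]; exact (hx i).2.2.1 h1
    · rw [key (by rw [← hc, h1]; decide)]; exact (hx i).2.2.2 h1
  · rw [compose_of_ne_zero X _ i hi]
    exact hx' i

/-- A point of the zonotope can have many preimages in the cube. The equality case of a termwise
inequality forces each preimage of a maximal point into the smaller box. -/
lemma inBox_of_map_le (hx : InBox (compose X (signOf t φ)) x) (hx' : InBox X x')
    (h : φ (∑ i, x i • veronese d (t i)) ≤ φ (∑ i, x' i • veronese d (t i))) :
    InBox (compose X (signOf t φ)) x' := by
  apply inBox_of_mul_eq hx hx'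
  rw [map_point, map_point] at h
  have hle := fun i (_ : i ∈ Finset.univ) => inBox_mul_le hx hx' i
  have := (Finset.sum_eq_sum_iff_of_le hle).mp (le_antisymm (Finset.sum_le_sum hle) h)
  exact fun i => this i (Finset.mem_univ i)

variable (t φ X) in
lemma maxLocus_cell : maxLocus (cell d t X) φ = cell d t (compose X (signOf t φ)) := by
  ext y
  constructor
  · rintro ⟨⟨x', hx', rfl⟩, hmax⟩
    obtain ⟨x, hx⟩ := exists_inBox (compose X (signOf t φ))
    refine ⟨x', inBox_of_map_le hx hx' (hmax _ ⟨x, ?_, rfl⟩), rfl⟩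
    exact hx.mono (compose_of_ne_zero X _)
  · rintro ⟨x, hx, rfl⟩
    refine ⟨⟨x, hx.mono (compose_of_ne_zero X _), rfl⟩, ?_⟩
    rintro _ ⟨x', hx', rfl⟩
    rw [map_point, map_point]
    exact Finset.sum_le_sum fun i _ => inBox_mul_le hx hx' i

variable (t φ) in
lemma maxLocus_cyclicZonotope :
    maxLocus (cyclicZonotope d t) φ = cell d t (signOf t φ) := by
  rw [cyclicZonotope_eq_cell, maxLocus_cell, compose_eq_right (by simp)]

/-- A nonzero sign of `φ` pins coordinate `i` of every preimage to one end. If `X i` were zero or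
opposite, some preimage would have that coordinate at the other end. That the larger cell is exposed
by a functional is essential, since preimages are not unique. -/
lemma eq_of_cell_subset (h : cell d t X ⊆ cell d t (signOf t φ)) (i : Fin n)
    (hi : signOf t φ i ≠ 0) : X i = signOf t φ i := by
  have key : ∀ x, InBox X x → InBox (signOf t φ) x := by
    intro x' hx'
    have h1 := h ⟨x', hx', rfl⟩
    obtain ⟨x, hx, hxx⟩ := h1
    have hc : compose 0 (signOf t φ) = signOf t φ := compose_eq_right (by simp)
    rw [← hc] at hx ⊢
    refine inBox_of_map_le hx (hx'.mono (by simp)) ?_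
    rw [hxx]
  obtain ⟨x, hx⟩ := exists_inBox X
  have hup : ∀ a : ℝ, 0 ≤ a → a ≤ 1 → X i = 0 → InBox X (Function.update x i a) := by
    intro a h0 h1 hX j
    by_cases hj : j = i
    · subst hj
      simp [h0, h1, hX]
    · rw [Function.update_of_ne hj]
      exact hx j
  have k0 := key x hx i
  rcases hs : signOf t φ i with _ | _ | _
  · exact absurd hs hi
  · rcases hX : X i with _ | _ | _
    · have := (key _ (hup 1 zero_le_one le_rfl hX) i).2.2.2 hs
      simp at this
    · rfl
    · have h1 := (hx i).2.2.1 hX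
      rw [k0.2.2.2 hs] at h1
      exact absurd h1 zero_ne_one
  · rcases hX : X i with _ | _ | _
    · have := (key _ (hup 0 le_rfl zero_le_one hX) i).2.2.1 hs
      simp at this
    · have h1 := (hx i).2.2.2 hX
      rw [k0.2.2.1 hs] at h1
      exact absurd h1 one_ne_zero
    · rfl

end Maximize

lemma cell_signOf_injective {t : Fin n → ℝ} {φ ψ : Module.Dual ℝ (Fin d → ℝ)}
    (h : cell d t (signOf t φ) = cell d t (signOf t ψ)) : signOf t φ = signOf t ψ := by
  funext i
  by_cases hi : signOf t ψ i = 0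
  · by_contra hne
    rw [hi] at hne
    exact hne ((eq_of_cell_subset h.symm.subset i hne).symm.trans hi)
  · exact eq_of_cell_subset h.subset i hi

lemma isFace_cell (t : Fin n → ℝ) (φ : Module.Dual ℝ (Fin d → ℝ)) :
    IsFace (cyclicZonotope d t) (cell d t (signOf t φ)) :=
  ⟨cell_nonempty t _, φ, (maxLocus_cyclicZonotope t φ).symm⟩

/-- A functional that defines a given face. -/
def functional {P : Set (Fin d → ℝ)} (F : Face P) : Module.Dual ℝ (Fin d → ℝ) := F.2.2.choose

/-- The sign vector of a face of a cyclic zonotope. -/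
def signVec (t : Fin n → ℝ) (F : Face (cyclicZonotope d t)) : Fin n → SignType :=
  signOf t (functional F)

lemma face_eq_cell (t : Fin n → ℝ) (F : Face (cyclicZonotope d t)) :
    (F : Set (Fin d → ℝ)) = cell d t (signVec t F) := by
  rw [signVec, ← maxLocus_cyclicZonotope]
  exact F.2.2.choose_spec

lemma signVec_injective (t : Fin n → ℝ) : Function.Injective (signVec (d := d) t) := by
  intro F G h
  apply Subtype.ext
  rw [face_eq_cell, face_eq_cell, h]

lemma exists_face (t : Fin n → ℝ) (φ : Module.Dual ℝ (Fin d → ℝ)) :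
    ∃ F : Face (cyclicZonotope d t), signVec t F = signOf t φ := by
  refine ⟨⟨_, isFace_cell t φ⟩, ?_⟩
  apply cell_signOf_injective
  exact (face_eq_cell t ⟨_, isFace_cell t φ⟩).symm

instance finite_face (t : Fin n → ℝ) : Finite (Face (cyclicZonotope d t)) :=
  Finite.of_injective _ (signVec_injective t)

/-! ### Linear spans and dimensions -/

lemma lin_cell (t : Fin n → ℝ) (X : Fin n → SignType) :
    lin (cell d t X) = Submodule.span ℝ (Set.range fun i : {i // X i = 0} =>
      veronese d (t i)) := by
  apply le_antisymm
  · rw [lin, vectorSpan_def, Submodule.span_le]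
    rintro _ ⟨_, ⟨x, hx, rfl⟩, _, ⟨y, hy, rfl⟩, rfl⟩
    simp only [vsub_eq_sub, SetLike.mem_coe]
    rw [← Finset.sum_sub_distrib]
    refine Submodule.sum_mem _ fun i _ => ?_
    rw [← sub_smul]
    rcases h : X i with _ | _ | _
    · exact Submodule.smul_mem _ _ (Submodule.subset_span ⟨⟨i, h⟩, rfl⟩)
    · rw [(hx i).2.2.2 h, (hy i).2.2.2 h, sub_self, zero_smul]
      exact Submodule.zero_mem _
    · rw [(hx i).2.2.1 h, (hy i).2.2.1 h, sub_self, zero_smul]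
      exact Submodule.zero_mem _
  · rw [Submodule.span_le]
    rintro _ ⟨⟨i, hi⟩, rfl⟩
    obtain ⟨x, hx⟩ := exists_inBox X
    have hup : ∀ a : ℝ, 0 ≤ a → a ≤ 1 → InBox X (Function.update x i a) := by
      intro a h0 h1 j
      by_cases hj : j = i
      · subst hj
        simp [h0, h1, hi]
      · rw [Function.update_of_ne hj]
        exact hx j
    have h := vsub_mem_vectorSpan ℝ
      (show _ ∈ cell d t X from ⟨_, hup 1 zero_le_one le_rfl, rfl⟩)
      (show _ ∈ cell d t X from ⟨_, hup 0 le_rfl zero_le_one, rfl⟩)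
    rw [vsub_eq_sub, ← Finset.sum_sub_distrib, Finset.sum_eq_single i] at h
    · simpa using h
    · intro j _ hj
      rw [Function.update_of_ne hj, Function.update_of_ne hj, sub_self]
    · simp

lemma veronese_mem_lin (t : Fin n → ℝ) {X : Fin n → SignType} {i : Fin n} (hi : X i = 0) :
    veronese d (t i) ∈ lin (cell d t X) := by
  rw [lin_cell]
  exact Submodule.subset_span ⟨⟨i, hi⟩, rfl⟩

/-! ### Independence of points on the Veronese curve -/

section Vandermonde

variable {t : Fin n → ℝ} (ht : Function.Injective t) {k : ℕ} {j : Fin k → Fin n}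
  (hj : Function.Injective j)
include ht hj

lemma det_vandermonde_comp_ne_zero : (Matrix.vandermonde (t ∘ j)).det ≠ 0 :=
  Matrix.det_vandermonde_ne_zero_iff.mpr (ht.comp hj)

/-- The first `k` coordinates of `k` points of the curve form a square Vandermonde matrix; this is
what makes diagonal frames admissible. -/
lemma combination_eq_zero (hk : k ≤ d) {c : Fin k → ℝ}
    (h : ∀ b : Fin d, (b : ℕ) < k → (∑ a, c a • veronese d (t (j a))) b = 0) : c = 0 := by
  apply Matrix.eq_zero_of_vecMul_eq_zero (det_vandermonde_comp_ne_zero ht hj)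
  funext b
  have := h (Fin.castLE hk b) b.2
  simpa [Finset.sum_apply, veronese, Matrix.vecMul, dotProduct, Matrix.vandermonde_apply]
    using this

lemma exists_combination (y : Fin d → ℝ) (hk : k ≤ d) : ∃ c : Fin k → ℝ,
    ∀ b : Fin d, (b : ℕ) < k → (∑ a, c a • veronese d (t (j a))) b = y b := by
  have hu : IsUnit (Matrix.vandermonde (t ∘ j)).det :=
    (det_vandermonde_comp_ne_zero ht hj).isUnit
  let y' : Fin k → ℝ := fun b => y (Fin.castLE hk b)
  refine ⟨Matrix.vecMul y' (Matrix.vandermonde (t ∘ j))⁻¹, fun b hb => ?_⟩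
  have h : Matrix.vecMul (Matrix.vecMul y' (Matrix.vandermonde (t ∘ j))⁻¹)
      (Matrix.vandermonde (t ∘ j)) = y' := by
    rw [Matrix.vecMul_vecMul, Matrix.nonsing_inv_mul _ hu, Matrix.vecMul_one]
  have h' := congrFun h ⟨b, hb⟩
  rw [Matrix.vecMul, dotProduct] at h'
  simpa [Finset.sum_apply, veronese, Matrix.vandermonde_apply, y'] using h'

lemma linearIndependent_veronese (hk : k ≤ d) :
    LinearIndependent ℝ fun a => veronese d (t (j a)) := by
  rw [Fintype.linearIndependent_iff]
  intro c hc a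
  rw [combination_eq_zero ht hj hk (c := c) (by rw [hc]; simp), Pi.zero_apply]

end Vandermonde

lemma exists_zeros (X : Fin n → SignType) {k : ℕ} (hk : k ≤ zeroCount X) :
    ∃ j : Fin k → Fin n, Function.Injective j ∧ ∀ a, X (j a) = 0 := by
  rw [zeroCount_eq_card, ← Fintype.card_fin k] at hk
  obtain ⟨e⟩ := Function.Embedding.nonempty_of_card_le hk
  exact ⟨fun a => e a, Subtype.val_injective.comp e.injective, fun a => (e a).2⟩

lemma span_le_lin {t : Fin n → ℝ} {X : Fin n → SignType} {k : ℕ} {j : Fin k → Fin n}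
    (hX : ∀ a, X (j a) = 0) :
    Submodule.span ℝ (Set.range fun a => veronese d (t (j a))) ≤ lin (cell d t X) := by
  rw [Submodule.span_le]
  rintro _ ⟨a, rfl⟩
  exact veronese_mem_lin t (hX a)

lemma dim_cell {t : Fin n → ℝ} (ht : Function.Injective t) (X : Fin n → SignType) :
    dim (cell d t X) = min d (zeroCount X) := by
  apply le_antisymm
  · refine le_min (dim_le _) ?_
    rw [dim, lin_cell, zeroCount_eq_card]
    exact finrank_range_le_card _
  · obtain ⟨j, hj, hX⟩ := exists_zeros X (min_le_right d _)
    have h := Submodule.finrank_mono (span_le_lin (d := d) (t := t) hX)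
    rwa [finrank_span_eq_card (linearIndependent_veronese ht hj (min_le_left _ _)),
      Fintype.card_fin] at h

lemma exists_combination_of_mem_lin {t : Fin n → ℝ} (ht : Function.Injective t)
    {X : Fin n → SignType} {k : ℕ} {j : Fin k → Fin n} (hj : Function.Injective j)
    (hX : ∀ a, X (j a) = 0) (hk : k = dim (cell d t X)) {w : Fin d → ℝ}
    (hw : w ∈ lin (cell d t X)) : ∃ c : Fin k → ℝ, w = ∑ a, c a • veronese d (t (j a)) := by
  have hkd : k ≤ d := hk ▸ dim_le _
  have h : Submodule.span ℝ (Set.range fun a => veronese d (t (j a))) = lin (cell d t X) := by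
    apply Submodule.eq_of_le_of_finrank_eq (span_le_lin hX)
    rw [finrank_span_eq_card (linearIndependent_veronese ht hj hkd), Fintype.card_fin]
    exact hk
  rw [← h, Submodule.mem_span_range_iff_exists_fun] at hw
  obtain ⟨c, hc⟩ := hw
  exact ⟨c, hc.symm⟩

section Truncation

variable {t : Fin n → ℝ} (ht : Function.Injective t) (X : Fin n → SignType)
include ht

lemma exists_basis_zeros : ∃ j : Fin (dim (cell d t X)) → Fin n,
    Function.Injective j ∧ ∀ a, X (j a) = 0 := by
  apply exists_zeros
  rw [dim_cell ht]
  exact min_le_right _ _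

variable {X} in
lemma eq_of_mem_lin {w w' : Fin d → ℝ} (hw : w ∈ lin (cell d t X)) (hw' : w' ∈ lin (cell d t X))
    (h : ∀ b : Fin d, (b : ℕ) < dim (cell d t X) → w b = w' b) : w = w' := by
  obtain ⟨j, hj, hX⟩ := exists_basis_zeros (d := d) ht X
  obtain ⟨c, hc⟩ := exists_combination_of_mem_lin ht hj hX rfl (Submodule.sub_mem _ hw hw')
  rw [← sub_eq_zero, hc]
  rw [combination_eq_zero ht hj (dim_le _) (c := c)]
  · simp
  · intro b hb
    rw [← hc, Pi.sub_apply, h b hb, sub_self]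

lemma exists_mem_lin (y : Fin d → ℝ) : ∃ w ∈ lin (cell d t X),
    ∀ b : Fin d, (b : ℕ) < dim (cell d t X) → w b = y b := by
  obtain ⟨j, hj, hX⟩ := exists_basis_zeros (d := d) ht X
  obtain ⟨c, hc⟩ := exists_combination ht hj y (dim_le _)
  exact ⟨_, Submodule.sum_mem _ fun a _ => Submodule.smul_mem _ _ (veronese_mem_lin t (hX a)), hc⟩

end Truncation

/-! ### Diagonal frames -/

/-- The vectors of the frame `v` are the multiples by `ρ` of those of the canonical frame. -/
structure IsDiagonal (v : Frame d) (ρ : ℕ → ℝ) : Prop where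
  ne_zero : ∀ m, ρ m ≠ 0
  apply_eq : ∀ i, v i = Pi.single i (ρ i)

lemma isDiagonal_canonicalFrame (d : ℕ) : IsDiagonal (canonicalFrame d) fun _ => 1 :=
  ⟨fun _ => one_ne_zero, fun i => by simp [canonicalFrame]⟩

lemma isDiagonal_alternatingFrame (d : ℕ) : IsDiagonal (alternatingFrame d) fun m => (-1) ^ m := by
  refine ⟨fun m => pow_ne_zero _ (by norm_num), fun i => ?_⟩
  ext b
  rw [alternatingFrame, Module.Basis.unitsSMul_apply, Pi.basisFun_apply, Units.smul_def]
  simp [Pi.single_apply]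

section Diagonal

variable {v : Frame d} {ρ : ℕ → ℝ} (hv : IsDiagonal v ρ)
include hv

lemma IsDiagonal.eq_sum (y : Fin d → ℝ) : y = ∑ i, (y i / ρ i) • v i := by
  ext b
  rw [Finset.sum_apply, Finset.sum_eq_single b]
  · rw [Pi.smul_apply, hv.apply_eq, Pi.single_eq_same, smul_eq_mul,
      div_mul_cancel₀ _ (hv.ne_zero _)]
  · intro i _ hi
    rw [Pi.smul_apply, hv.apply_eq, Pi.single_eq_of_ne hi.symm, smul_zero]
  · simp

lemma IsDiagonal.proj_apply (k : ℕ) (y : Fin d → ℝ) (b : Fin d) :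
    proj v k y b = if (b : ℕ) < k then y b else 0 := by
  conv_lhs => rw [hv.eq_sum y]
  rw [map_sum, Finset.sum_apply, Finset.sum_eq_single b]
  · rw [map_smul, proj, Module.Basis.constr_basis]
    split_ifs with h
    · rw [Pi.smul_apply, hv.apply_eq, Pi.single_eq_same, smul_eq_mul,
        div_mul_cancel₀ _ (hv.ne_zero _)]
    · simp
  · intro i _ hi
    rw [map_smul, proj, Module.Basis.constr_basis]
    split_ifs with h
    · rw [Pi.smul_apply, hv.apply_eq, Pi.single_eq_of_ne hi.symm, smul_zero]
    · simp
  · simp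

lemma IsDiagonal.mem_frameSpan {k : ℕ} {y : Fin d → ℝ} :
    y ∈ frameSpan v k ↔ ∀ b : Fin d, k ≤ b → y b = 0 := by
  constructor
  · intro hy b hb
    induction hy using Submodule.span_induction with
    | mem x hx =>
      obtain ⟨i, hi, rfl⟩ := hx
      have hne : b ≠ i := by rintro rfl; omega
      rw [hv.apply_eq, Pi.single_eq_of_ne hne]
    | zero => rfl
    | add x y _ _ hx hy => rw [Pi.add_apply, hx, hy, add_zero]
    | smul a x _ hx => rw [Pi.smul_apply, hx, smul_zero]
  · intro h
    rw [hv.eq_sum y]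
    refine Submodule.sum_mem _ fun i _ => ?_
    by_cases hi : (i : ℕ) < k
    · exact Submodule.smul_mem _ _ (Submodule.subset_span ⟨i, hi, rfl⟩)
    · rw [h i (not_lt.mp hi), zero_div, zero_smul]
      exact Submodule.zero_mem _

variable {t : Fin n → ℝ} (ht : Function.Injective t)
include ht

lemma bijOn_proj (X : Fin n → SignType) :
    Set.BijOn (proj v (dim (cell d t X))) (lin (cell d t X)) (frameSpan v (dim (cell d t X))) := by
  refine ⟨?_, ?_, ?_⟩
  · intro w _
    rw [SetLike.mem_coe, hv.mem_frameSpan]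
    intro b hb
    rw [hv.proj_apply, if_neg (not_lt.mpr hb)]
  · intro w hw w' hw' h
    refine eq_of_mem_lin ht hw hw' fun b hb => ?_
    have := congrFun h b
    rwa [hv.proj_apply, hv.proj_apply, if_pos hb, if_pos hb] at this
  · intro y hy
    rw [SetLike.mem_coe, hv.mem_frameSpan] at hy
    obtain ⟨w, hw, h⟩ := exists_mem_lin ht X y
    refine ⟨w, hw, ?_⟩
    ext b
    rw [hv.proj_apply]
    split_ifs with hb
    · exact h b hb
    · exact (hy b (not_lt.mp hb)).symm

/-- Diagonal frames are admissible for cyclic zonotopes. -/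
lemma isFramed_cyclicZonotope : IsFramed (cyclicZonotope d t) v := by
  refine ⟨isPolytope_cyclicZonotope t, fun F hF => ?_⟩
  have h : F = cell d t (signVec t ⟨F, hF⟩) := face_eq_cell t ⟨F, hF⟩
  rw [h]
  exact bijOn_proj hv ht _

lemma lift_mem (X : Fin n → SignType) {i : Fin d} (hi : (i : ℕ) < dim (cell d t X)) :
    lift v (cell d t X) (v i) ∈ lin (cell d t X) := by
  have h := (bijOn_proj hv ht X).surjOn (Submodule.subset_span ⟨i, hi, rfl⟩)
  exact Function.invFunOn_mem h

lemma lift_apply (X : Fin n → SignType) {i : Fin d} (hi : (i : ℕ) < dim (cell d t X))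
    {b : Fin d} (hb : (b : ℕ) < dim (cell d t X)) : lift v (cell d t X) (v i) b = v i b := by
  have h := (bijOn_proj hv ht X).surjOn (Submodule.subset_span ⟨i, hi, rfl⟩)
  have h' := congrFun (Function.invFunOn_eq h) b
  rwa [hv.proj_apply, if_pos hb] at h'

end Diagonal

/-! ### Orientations -/

/-- Both sides are alternating in the rows of `A`, so it is enough to compare them on permutations
of the standard basis. -/
lemma map_matrix_eq_det_smul {k : ℕ} {M N : Type*} [AddCommGroup M] [Module ℝ M]
    [AddCommGroup N] [Module ℝ N] (f : M [⋀^Fin k]→ₗ[ℝ] N) (A : Matrix (Fin k) (Fin k) ℝ)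
    (u : Fin k → M) : f (fun a => ∑ b, A a b • u b) = A.det • f u := by
  have h : f.compLinearMap (Fintype.linearCombination ℝ u) =
      (LinearMap.toSpanSingleton ℝ N (f u)).compAlternatingMap
        (Matrix.detRowAlternating (R := ℝ) (n := Fin k)) := by
    refine Module.Basis.ext_alternating (Pi.basisFun ℝ (Fin k)) fun i hi => ?_
    let σ : Equiv.Perm (Fin k) := Equiv.ofBijective i (Finite.injective_iff_bijective.1 hi)
    change (f.compLinearMap (Fintype.linearCombination ℝ u)) (Pi.basisFun ℝ (Fin k) ∘ σ) =
      ((LinearMap.toSpanSingleton ℝ N (f u)).compAlternatingMap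
        (Matrix.detRowAlternating (R := ℝ) (n := Fin k))) (Pi.basisFun ℝ (Fin k) ∘ σ)
    rw [AlternatingMap.map_perm, AlternatingMap.map_perm]
    congr 1
    have h1 : Matrix.detRowAlternating (R := ℝ) (Pi.basisFun ℝ (Fin k)) = 1 := by
      rw [← Pi.basisFun_det, Module.Basis.det_self]
    rw [LinearMap.compAlternatingMap_apply, h1, LinearMap.toSpanSingleton_apply, one_smul,
      AlternatingMap.compLinearMap_apply]
    congr 1
    funext a
    simp
  exact DFunLike.congr_fun h A

lemma ιMulti_snoc {M : Type*} [AddCommGroup M] [Module ℝ M] {k : ℕ} (u : Fin k → M) (w : M) :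
    ExteriorAlgebra.ιMulti ℝ (k + 1) (Fin.snoc u w : Fin (k + 1) → M) =
      ExteriorAlgebra.ιMulti ℝ k u * ExteriorAlgebra.ι ℝ w := by
  rw [ExteriorAlgebra.ιMulti_apply, ExteriorAlgebra.ιMulti_apply, List.ofFn_succ']
  simp [List.concat_eq_append]

/-- The first `k` coordinates of a vector. -/
def truncate (d k : ℕ) : (Fin d → ℝ) →ₗ[ℝ] (Fin k → ℝ) :=
  LinearMap.pi fun a => if h : (a : ℕ) < d then LinearMap.proj ⟨a, h⟩ else 0

section Orientation

variable {v : Frame d} {ρ : ℕ → ℝ} (hv : IsDiagonal v ρ) {t : Fin n → ℝ}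
  (ht : Function.Injective t)
include hv ht

/-- A vector of the span of a `k`-face is determined by its first `k` coordinates, so its
coefficients in the lifted frame are these coordinates divided by the scales `ρ`. -/
lemma ιMulti_eq_det_smul (X : Fin n → SignType) {k : ℕ} (hk : k = dim (cell d t X)) (hkd : k ≤ d)
    {w : Fin k → Fin d → ℝ} (hw : ∀ a, w a ∈ lin (cell d t X)) :
    ExteriorAlgebra.ιMulti ℝ k w =
      (Matrix.of fun a b : Fin k => (ρ b)⁻¹ * w a (Fin.castLE hkd b)).det •
        inducedOrientation v (cell d t X) := by
  subst hk
  rw [inducedOrientation, ← map_matrix_eq_det_smul]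
  congr 1
  funext a
  refine eq_of_mem_lin ht (hw a) (Submodule.sum_mem _ fun b _ => Submodule.smul_mem _ _
    (lift_mem hv ht X b.2)) fun b hb => ?_
  rw [Finset.sum_apply, Finset.sum_eq_single ⟨b, hb⟩]
  · have h := lift_apply hv ht X (i := b) hb hb
    rw [Pi.smul_apply]
    refine Eq.symm (Eq.trans (congrArg (_ • ·) h) ?_)
    rw [hv.apply_eq, Pi.single_eq_same]
    have hne := hv.ne_zero b
    simp only [Matrix.of_apply, smul_eq_mul]
    rw [mul_right_comm, inv_mul_cancel₀ hne, one_mul]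
    rfl
  · intro c _ hc
    rw [Pi.smul_apply, lift_apply hv ht X c.2 hb, hv.apply_eq, Pi.single_eq_of_ne, smul_zero]
    rintro rfl
    exact hc rfl
  · simp

lemma inducedOrientation_ne_zero (X : Fin n → SignType) :
    inducedOrientation v (cell d t X) ≠ 0 := by
  intro h0
  -- The determinant of the first `k` coordinates extends to the exterior algebra and takes the
  -- value `∏ ρ i` on the orientation.
  have h := congrArg (ExteriorAlgebra.liftAlternating (R := ℝ) fun k =>
    (Matrix.detRowAlternating (R := ℝ) (n := Fin k)).compLinearMap (truncate d k)) h0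
  rw [map_zero, inducedOrientation, ExteriorAlgebra.liftAlternating_apply_ιMulti,
    AlternatingMap.compLinearMap_apply] at h
  have hM : (fun i : Fin (dim (cell d t X)) => truncate d (dim (cell d t X))
      (lift v (cell d t X) (v (Fin.castLE (dim_le _) i)))) =
      (Matrix.diagonal fun i : Fin (dim (cell d t X)) => ρ i) := by
    funext a b
    have hb : (b : ℕ) < d := b.2.trans_le (dim_le _)
    have h1 : truncate d (dim (cell d t X)) (lift v (cell d t X) (v (Fin.castLE (dim_le _) a))) b =
        lift v (cell d t X) (v (Fin.castLE (dim_le _) a)) ⟨b, hb⟩ := by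
      simp [truncate, hb]
    rw [h1, lift_apply hv ht X (i := Fin.castLE (dim_le _) a) a.2 (b := ⟨b, hb⟩) b.2, hv.apply_eq,
      Matrix.diagonal_apply, Pi.single_apply]
    by_cases hab : a = b
    · subst hab
      rw [if_pos (show (⟨a, hb⟩ : Fin d) = Fin.castLE (dim_le _) a from rfl), if_pos rfl]
      rfl
    · have : (⟨b, hb⟩ : Fin d) ≠ Fin.castLE (dim_le _) a := fun h =>
        hab (Fin.ext (congrArg Fin.val h).symm)
      rw [if_neg this, if_neg hab]
  have h2 : (Matrix.diagonal fun i : Fin (dim (cell d t X)) => ρ i).det = 0 := by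
    rw [← hM]; exact h
  rw [Matrix.det_diagonal, Finset.prod_eq_zero_iff] at h2
  obtain ⟨a, -, ha⟩ := h2
  exact hv.ne_zero _ ha

end Orientation

lemma det_vandermonde_snoc {k : ℕ} (u : Fin k → ℝ) (a : ℝ) :
    (Matrix.vandermonde (Fin.snoc u a : Fin (k + 1) → ℝ)).det =
      (Matrix.vandermonde u).det * ∏ i, (a - u i) := by
  have h : ∀ {m : ℕ} (u : Fin m → ℝ), (Matrix.vandermonde u).det =
      ∏ i, ∏ j, if i < j then u j - u i else 1 := by
    intro m u
    rw [Matrix.det_vandermonde]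
    refine Finset.prod_congr rfl fun i _ => ?_
    rw [← Finset.prod_filter, Finset.filter_lt_eq_Ioi]
  rw [h, h, Fin.prod_univ_castSucc, ← Finset.prod_mul_distrib]
  have hl : ∏ j, (if Fin.last k < j then (Fin.snoc u a : Fin (k + 1) → ℝ) j -
      (Fin.snoc u a : Fin (k + 1) → ℝ) (Fin.last k) else 1) = 1 :=
    Finset.prod_eq_one fun j _ => if_neg (Fin.le_last j).not_gt
  rw [hl, mul_one]
  refine Finset.prod_congr rfl fun i _ => ?_
  rw [Fin.prod_univ_castSucc]
  simp [Fin.castSucc_lt_last]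

/-! ### Sources and targets -/

lemma exists_zeros_equiv (t : Fin n → ℝ) (Y : Fin n → SignType) :
    ∃ j : Fin (zeroCount Y) → Fin n, Function.Injective j ∧ (∀ a, Y (j a) = 0) ∧
      ∀ x, ∏ a, (x - t (j a)) = nodal t Y x := by
  have e : Fin (zeroCount Y) ≃ {i // Y i = 0} :=
    (Fintype.equivFinOfCardEq (zeroCount_eq_card Y).symm).symm
  refine ⟨fun a => e a, Subtype.val_injective.comp e.injective, fun a => (e a).2, fun x => ?_⟩
  rw [Equiv.prod_comp e fun i => x - t i, nodal, ← Finset.prod_filter]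
  exact (Finset.prod_subtype _ (by simp) fun i => x - t i).symm

lemma apply_eq_zero_of_mem_lin {P : Set (Fin d → ℝ)} {ν : Module.Dual ℝ (Fin d → ℝ)}
    {w : Fin d → ℝ} (hw : w ∈ lin (maxLocus P ν)) : ν w = 0 := by
  suffices h : lin (maxLocus P ν) ≤ LinearMap.ker ν from h hw
  rw [lin, vectorSpan_def, Submodule.span_le]
  rintro _ ⟨x, hx, y, hy, rfl⟩
  simp only [vsub_eq_sub, SetLike.mem_coe, LinearMap.mem_ker, map_sub]
  exact sub_eq_zero.mpr (le_antisymm (hy.2 x hx.1) (hx.2 y hy.1))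

lemma isFacet_cell_iff {t : Fin n → ℝ} {φ ψ : Module.Dual ℝ (Fin d → ℝ)} :
    IsFacet (cell d t (signOf t φ)) (cell d t (signOf t ψ)) ↔
      (∀ i, signOf t φ i ≠ 0 → signOf t ψ i = signOf t φ i) ∧
        dim (cell d t (signOf t ψ)) + 1 = dim (cell d t (signOf t φ)) := by
  refine and_congr_left fun _ => ⟨?_, fun h => ?_⟩
  · rintro ⟨-, χ, hχ⟩ i hi
    refine eq_of_cell_subset (φ := φ) ?_ i hi
    rw [hχ]
    exact fun x hx => hx.1
  · refine ⟨cell_nonempty t _, ψ, ?_⟩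
    rw [maxLocus_cell, compose_eq_right h]

lemma eq_zero_of_extend {X Y : Fin n → SignType} (hXY : ∀ i, X i ≠ 0 → Y i = X i) {i : Fin n}
    (hi : Y i = 0) : X i = 0 := by
  by_contra h
  exact h ((hXY i h).symm.trans hi)

/-! ### Wedging the orientation of a facet with a vector -/

section Facet

variable {v : Frame d} {ρ : ℕ → ℝ} (hv : IsDiagonal v ρ) {t : Fin n → ℝ}
  (ht : Function.Injective t) {X Y : Fin n → SignType} (hXY : ∀ i, X i ≠ 0 → Y i = X i)
  (hdim : dim (cell d t Y) + 1 = dim (cell d t X))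
include ht hdim

lemma zeroCount_of_facet : zeroCount Y + 1 = dim (cell d t X) := by
  have h1 := dim_cell (d := d) ht Y
  have h2 := dim_le (cell d t X)
  omega

include hv hXY

/-- Expanding the wedge of the generators of `Y`, and of the same generators followed by `ξ(t i)`,
gives two Vandermonde determinants. Their quotient is the nodal product, and the frame contributes
one extra scale. If `Y i = 0`, both sides vanish. -/
lemma inducedOrientation_mul_ι {i : Fin n} (hi : X i = 0) :
    inducedOrientation v (cell d t Y) * ExteriorAlgebra.ι ℝ (veronese d (t i)) =
      ((ρ (zeroCount Y))⁻¹ * nodal t Y (t i)) • inducedOrientation v (cell d t X) := by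
  obtain ⟨j, hj, hY, hnod⟩ := exists_zeros_equiv t Y
  have hm := zeroCount_of_facet ht hdim
  have hmd : zeroCount Y + 1 ≤ d := hm ▸ dim_le _
  have hdet : ∀ {k : ℕ} (hkd : k ≤ d) (l : Fin k → Fin n),
      (Matrix.of fun a b : Fin k => (ρ b)⁻¹ * veronese d (t (l a)) (Fin.castLE hkd b)).det =
        (∏ b : Fin k, (ρ b)⁻¹) * (Matrix.vandermonde (t ∘ l)).det := fun hkd l =>
    Matrix.det_mul_row (fun b : Fin _ => (ρ b)⁻¹) (Matrix.vandermonde (t ∘ l))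
  have h1 := ιMulti_eq_det_smul hv ht Y (k := zeroCount Y) (by omega) (by omega)
    (w := fun a => veronese d (t (j a))) fun a => veronese_mem_lin t (hY a)
  rw [hdet] at h1
  let l : Fin (zeroCount Y + 1) → Fin n := Fin.snoc j i
  have hl : ∀ a, X (l a) = 0 := by
    intro a
    induction a using Fin.lastCases with
    | last => simpa [l] using hi
    | cast a => simpa [l] using eq_zero_of_extend hXY (hY a)
  have h2 := ιMulti_eq_det_smul hv ht X hm hmd
    (w := fun a => veronese d (t (l a))) fun a => veronese_mem_lin t (hl a)
  have hs : (fun a => veronese d (t (l a))) =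
      (Fin.snoc (fun a => veronese d (t (j a))) (veronese d (t i)) :
        Fin (zeroCount Y + 1) → Fin d → ℝ) := by
    funext a
    induction a using Fin.lastCases with
    | last => simp [l]
    | cast a => simp [l]
  have hs' : t ∘ l = (Fin.snoc (t ∘ j) (t i) : Fin (zeroCount Y + 1) → ℝ) := by
    funext a
    induction a using Fin.lastCases with
    | last => simp [l]
    | cast a => simp [l]
  rw [hdet, hs, ιMulti_snoc, h1, hs', det_vandermonde_snoc, Fin.prod_univ_castSucc,
    smul_mul_assoc] at h2
  simp only [Function.comp_apply, hnod, Fin.val_castSucc, Fin.val_last] at h2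
  have hne : (∏ b : Fin (zeroCount Y), (ρ b)⁻¹) * (Matrix.vandermonde (t ∘ j)).det ≠ 0 :=
    mul_ne_zero (Finset.prod_ne_zero_iff.mpr fun b _ => inv_ne_zero (hv.ne_zero b))
      (det_vandermonde_comp_ne_zero ht hj)
  refine smul_right_injective _ hne ?_
  dsimp only
  rw [h2, smul_smul]
  congr 1
  ring

/-- Modulo the span of `Y`, the vector `w` is a multiple of `ξ(t i)`. Both `ν` and the wedge with
`β_Y` kill that span, so both sides are linear in this multiple; hence the choice of `w` and `ν` is
immaterial to the sign rule. -/
lemma smul_inducedOrientation_mul_ι {ν : Module.Dual ℝ (Fin d → ℝ)}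
    (hν : ν ∈ normalCone (cell d t X) (cell d t Y)) {w : Fin d → ℝ} (hw : w ∈ lin (cell d t X))
    {i : Fin n} (hi : X i = 0) (hi' : Y i ≠ 0) :
    ν (veronese d (t i)) • (inducedOrientation v (cell d t Y) * ExteriorAlgebra.ι ℝ w) =
      (ν w * ((ρ (zeroCount Y))⁻¹ * nodal t Y (t i))) • inducedOrientation v (cell d t X) := by
  obtain ⟨j, hj, hY, hnod⟩ := exists_zeros_equiv t Y
  have hm := zeroCount_of_facet ht hdim
  let l : Fin (zeroCount Y + 1) → Fin n := Fin.snoc j i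
  have hl : ∀ a, X (l a) = 0 := by
    intro a
    induction a using Fin.lastCases with
    | last => simpa [l] using hi
    | cast a => simpa [l] using eq_zero_of_extend hXY (hY a)
  have hlinj : Function.Injective l :=
    Fin.snoc_injective_of_injective hj fun ⟨a, ha⟩ => hi' (ha ▸ hY a)
  obtain ⟨c, hc⟩ := exists_combination_of_mem_lin ht hlinj hl hm hw
  rw [Fin.sum_univ_castSucc] at hc
  simp only [l, Fin.snoc_castSucc, Fin.snoc_last] at hc
  have hν0 : ∀ a, ν (veronese d (t (j a))) = 0 := by
    intro a
    apply apply_eq_zero_of_mem_lin (P := cell d t X)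
    rw [← show cell d t Y = maxLocus (cell d t X) ν from hν]
    exact veronese_mem_lin t (hY a)
  have hβ0 : ∀ a, inducedOrientation v (cell d t Y) *
      ExteriorAlgebra.ι ℝ (veronese d (t (j a))) = 0 := by
    intro a
    rw [inducedOrientation_mul_ι hv ht hXY hdim (eq_zero_of_extend hXY (hY a)), ← hnod,
      Finset.prod_eq_zero (Finset.mem_univ a) (sub_self _), mul_zero, zero_smul]
  have h1 : ν w = c (Fin.last _) * ν (veronese d (t i)) := by
    rw [hc, map_add, map_sum]
    simp [hν0]
  have h2 : inducedOrientation v (cell d t Y) * ExteriorAlgebra.ι ℝ w = c (Fin.last _) •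
      (inducedOrientation v (cell d t Y) * ExteriorAlgebra.ι ℝ (veronese d (t i))) := by
    rw [hc, map_add, map_sum, mul_add, Finset.mul_sum]
    simp [hβ0]
  rw [h2, inducedOrientation_mul_ι hv ht hXY hdim hi, h1, smul_smul, smul_smul]
  congr 1
  ring

end Facet

lemma sign_inv_mul (a b : ℝ) : SignType.sign (a⁻¹ * b) = SignType.sign (a * b) := by
  rw [sign_mul, sign_mul]
  congr 1
  rcases lt_trichotomy a 0 with h | h | h
  · rw [sign_neg h, sign_neg (inv_lt_zero.mpr h)]
  · rw [h, inv_zero]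
  · rw [sign_pos h, sign_pos (inv_pos.mpr h)]

section SourceTarget

variable {v : Frame d} {ρ : ℕ → ℝ} (hv : IsDiagonal v ρ) {t : Fin n → ℝ}
  (ht : Function.Injective t)
include hv ht

lemma exists_wedge_iff_signRel {s : SignType} {φ ψ : Module.Dual ℝ (Fin d → ℝ)} :
    (IsFacet (cell d t (signOf t φ)) (cell d t (signOf t ψ)) ∧
      ∃ w ∈ lin (cell d t (signOf t φ)),
        ∃ ν ∈ normalCone (cell d t (signOf t φ)) (cell d t (signOf t ψ)),
        SignType.sign (ν w) = s ∧ SameOrientation (inducedOrientation v (cell d t (signOf t φ)))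
          (inducedOrientation v (cell d t (signOf t ψ)) * ExteriorAlgebra.ι ℝ w)) ↔
      zeroCount (signOf t ψ) + 1 = dim (cell d t (signOf t φ)) ∧
        SignRel t ρ s (signOf t φ) (signOf t ψ) := by
  constructor
  · rintro ⟨hfac, w, hw, ν, hν, hsign, r, hr, hβ⟩
    obtain ⟨hXY, hdim⟩ := isFacet_cell_iff.mp hfac
    refine ⟨zeroCount_of_facet ht hdim, fun i => ⟨hXY i, fun hi => ?_⟩⟩
    by_cases hi' : signOf t ψ i = 0
    · exact Or.inl hi'
    right
    have h := smul_inducedOrientation_mul_ι hv ht hXY hdim hν hw hi hi'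
    have h2 := congrArg (r • ·) h
    rw [smul_comm, ← hβ, smul_smul] at h2
    have h3 := smul_left_injective ℝ (inducedOrientation_ne_zero hv ht (signOf t φ)) h2
    have h4 : SignType.sign (ν (veronese d (t i))) = signOf t ψ i := by
      have h5 := hν
      rw [normalCone, Set.mem_ofPred_eq, maxLocus_cell] at h5
      have h6 := eq_of_cell_subset h5.symm.subset i hi'
      rw [← h6, compose, if_pos hi]
      rfl
    rw [← h4, h3, sign_mul, sign_mul, sign_pos hr, one_mul, hsign, sign_inv_mul]
  · rintro ⟨hz, hrel⟩
    have hdim : dim (cell d t (signOf t ψ)) + 1 = dim (cell d t (signOf t φ)) := by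
      have h1 := dim_cell (d := d) ht (signOf t ψ)
      have h2 := dim_le (cell d t (signOf t φ))
      omega
    have hXY := fun i => (hrel i).1
    refine ⟨isFacet_cell_iff.mpr ⟨hXY, hdim⟩, ?_⟩
    obtain ⟨i, hi, hi'⟩ : ∃ i, signOf t φ i = 0 ∧ signOf t ψ i ≠ 0 := by
      by_contra! h
      have : signOf t ψ = signOf t φ := by
        funext i
        by_cases hi : signOf t φ i = 0
        · rw [h i hi, hi]
        · exact hXY i hi
      rw [this] at hdim
      omega
    have hY := ((hrel i).2 hi).resolve_left hi'
    have hsq : ∀ a : SignType, a ≠ 0 → a * a = 1 := by decide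
    -- With this sign, `ψ` takes a value of sign `s` on `a • ξ(t i)`; the sign rule at `i` then
    -- makes the orientation scalar positive.
    obtain ⟨a, ha⟩ : ∃ a : ℝ, SignType.sign a = s * signOf t ψ i := by
      generalize s * signOf t ψ i = b
      rcases b with _ | _ | _
      exacts [⟨0, sign_zero⟩, ⟨-1, by simp⟩, ⟨1, sign_one⟩]
    refine ⟨a • veronese d (t i), Submodule.smul_mem _ _ (veronese_mem_lin t hi), ψ, ?_, ?_, ?_⟩
    · rw [normalCone, Set.mem_ofPred_eq, maxLocus_cell, compose_eq_right hXY]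
    · rw [map_smul, smul_eq_mul, sign_mul, ha]
      exact (mul_assoc _ _ _).trans (by rw [← signOf, hsq _ hi', mul_one])
    · rw [map_smul, mul_smul_comm, inducedOrientation_mul_ι hv ht hXY hdim hi, smul_smul]
      have hpos : 0 < a * ((ρ (zeroCount (signOf t ψ)))⁻¹ * nodal t (signOf t ψ) (t i)) := by
        rw [← sign_eq_one_iff, sign_mul, ha, sign_inv_mul, mul_right_comm, ← hY,
          hsq _ hi']
      exact ⟨_, inv_pos.mpr hpos, by rw [smul_smul, inv_mul_cancel₀ hpos.ne', one_smul]⟩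

lemma mem_tgt_iff (F E : Face (cyclicZonotope d t)) : E ∈ tgt (cyclicZonotope d t) v F ↔
    zeroCount (signVec t E) + 1 = dim (F : Set (Fin d → ℝ)) ∧
      SignRel t ρ 1 (signVec t F) (signVec t E) := by
  rw [tgt, Set.mem_ofPred_eq, target, Set.mem_ofPred_eq, face_eq_cell t F, face_eq_cell t E]
  refine Iff.trans ?_ (exists_wedge_iff_signRel hv ht)
  simp only [sign_eq_one_iff, signVec]

lemma mem_src_iff (F E : Face (cyclicZonotope d t)) : E ∈ src (cyclicZonotope d t) v F ↔
    zeroCount (signVec t E) + 1 = dim (F : Set (Fin d → ℝ)) ∧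
      SignRel t ρ (-1) (signVec t F) (signVec t E) := by
  rw [src, Set.mem_ofPred_eq, source, Set.mem_ofPred_eq, face_eq_cell t F, face_eq_cell t E]
  refine Iff.trans ?_ (exists_wedge_iff_signRel hv ht)
  simp only [sign_eq_neg_one_iff, signVec]

end SourceTarget

/-! ### Realizing sign vectors -/

/-- Functionals restricted to the Veronese curve are the polynomials of degree less than `d`, so the
nodal polynomial is available only for fewer than `d` zeros. -/
lemma exists_functional_nodal (t : Fin n → ℝ) {Y : Fin n → SignType} (hY : zeroCount Y < d)
    (c : ℝ) : ∃ χ : Module.Dual ℝ (Fin d → ℝ), ∀ a, χ (veronese d a) = c * nodal t Y a := by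
  let p : Polynomial ℝ := ∏ j, if Y j = 0 then Polynomial.X - Polynomial.C (t j) else 1
  have hp : p.natDegree < d := by
    refine lt_of_le_of_lt (Polynomial.natDegree_prod_le _ _) (lt_of_le_of_lt ?_ hY)
    refine Finset.sum_le_sum fun j _ => ?_
    split_ifs
    · exact (Polynomial.natDegree_X_sub_C _).le
    · exact Polynomial.natDegree_one.le
  refine ⟨c • ∑ b : Fin d, p.coeff b • LinearMap.proj b, fun a => ?_⟩
  have h1 : p.eval a = nodal t Y a := by
    rw [Polynomial.eval_prod, nodal]
    refine Finset.prod_congr rfl fun j _ => ?_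
    split_ifs <;> simp
  rw [← h1, Polynomial.eval_eq_sum_range' hp,
    ← Fin.sum_univ_eq_sum_range fun b => p.coeff b * a ^ b]
  simp [veronese]

lemma exists_pos_perturbation {ι : Type*} [Finite ι] (a b : ι → ℝ) :
    ∃ ε : ℝ, 0 < ε ∧ ∀ i, a i ≠ 0 → SignType.sign (a i + ε * b i) = SignType.sign (a i) := by
  have h : ∀ i, ∀ᶠ ε : ℝ in nhdsWithin 0 (Set.Ioi 0),
      a i ≠ 0 → SignType.sign (a i + ε * b i) = SignType.sign (a i) := by
    intro i
    have hlim : Filter.Tendsto (fun ε : ℝ => a i + ε * b i) (nhdsWithin 0 (Set.Ioi 0))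
        (nhds (a i)) := by
      have : Continuous fun ε : ℝ => a i + ε * b i := by fun_prop
      simpa using (this.tendsto 0).mono_left nhdsWithin_le_nhds
    rcases lt_trichotomy (a i) 0 with h | h | h
    · filter_upwards [hlim.eventually_lt_const h] with ε hε _
      rw [sign_neg hε, sign_neg h]
    · exact Filter.Eventually.of_forall fun ε hne => absurd h hne
    · filter_upwards [hlim.eventually_const_lt h] with ε hε _
      rw [sign_pos hε, sign_pos h]
  obtain ⟨ε, h1, h2⟩ := ((Filter.eventually_all.mpr h).and self_mem_nhdsWithin).exists
  exact ⟨ε, h2, h1⟩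

/-- A small multiple of the nodal polynomial, added to a functional defining `F`, keeps the nonzero
signs. At the zeros of `F` it leaves exactly the signs demanded by the rule, including the zeros of
`Y`. -/
lemma exists_face_of_signRel (t : Fin n → ℝ) (ρ : ℕ → ℝ) {s : SignType}
    (F : Face (cyclicZonotope d t)) {Y : Fin n → SignType} (hY : zeroCount Y < d)
    (h : SignRel t ρ s (signVec t F) Y) : ∃ E : Face (cyclicZonotope d t), signVec t E = Y := by
  obtain ⟨c, hc⟩ : ∃ c : ℝ, SignType.sign c = s := by
    rcases s with _ | _ | _
    exacts [⟨0, sign_zero⟩, ⟨-1, by simp⟩, ⟨1, sign_one⟩]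
  obtain ⟨χ, hχ⟩ := exists_functional_nodal t hY (c * ρ (zeroCount Y))
  obtain ⟨ε, hε, hpert⟩ := exists_pos_perturbation
    (fun i => functional F (veronese d (t i))) fun i => χ (veronese d (t i))
  obtain ⟨E, hE⟩ := exists_face t (functional F + ε • χ)
  refine ⟨E, hE.trans ?_⟩
  funext i
  rw [signOf, LinearMap.add_apply, LinearMap.smul_apply, smul_eq_mul]
  by_cases hi : signVec t F i = 0
  · have h0 : functional F (veronese d (t i)) = 0 := sign_eq_zero_iff.mp hi
    rw [h0, zero_add, sign_mul, sign_pos hε, one_mul, hχ, mul_assoc, sign_mul, hc]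
    rcases (h i).2 hi with hYi | hYi
    · have : nodal t Y (t i) = 0 :=
        Finset.prod_eq_zero (Finset.mem_univ i) (by rw [if_pos hYi, sub_self])
      rw [this, mul_zero, sign_zero, mul_zero, hYi]
    · exact hYi.symm
  · rw [hpert i (sign_ne_zero.mp hi), (h i).1 hi]
    rfl

/-- With `d` nodes, Lagrange interpolation prescribes the values of a polynomial of degree less than
`d` arbitrarily. -/
lemma signVec_surjective {t : Fin d → ℝ} (ht : Function.Injective t) :
    Function.Surjective (signVec (d := d) t) := by
  intro X
  have hu : IsUnit (Matrix.vandermonde t).det :=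
    (Matrix.det_vandermonde_ne_zero_iff.mpr ht).isUnit
  let y : Fin d → ℝ := fun i => (X i : ℝ)
  let a := Matrix.mulVec (Matrix.vandermonde t)⁻¹ y
  have ha : Matrix.mulVec (Matrix.vandermonde t) a = y := by
    rw [Matrix.mulVec_mulVec, Matrix.mul_nonsing_inv _ hu, Matrix.one_mulVec]
  obtain ⟨F, hF⟩ := exists_face t (∑ b : Fin d, a b • LinearMap.proj b)
  refine ⟨F, hF.trans ?_⟩
  funext i
  have hi : (∑ b : Fin d, a b • LinearMap.proj b : Module.Dual ℝ (Fin d → ℝ))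
      (veronese d (t i)) = X i := by
    have := congrFun ha i
    simp only [Matrix.mulVec, dotProduct, Matrix.vandermonde_apply, y] at this
    rw [← this, LinearMap.sum_apply]
    exact Finset.sum_congr rfl fun b _ => mul_comm _ _
  rw [signOf, hi]
  rcases X i with _ | _ | _ <;> simp

/-! ### The chain complex of a framed cyclic zonotope -/

lemma finsum_single_apply {B : Type} [Finite B] (A : Set B) (b : B) :
    (∑ᶠ a ∈ A, Finsupp.single a (1 : ℤ)) b = A.indicator 1 b := by
  classical
  rw [finsum_mem_eq_finite_toFinset_sum _ A.toFinite, Finsupp.finsetSum_apply]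
  simp [Finsupp.single_apply, Set.indicator_apply]

lemma chains_bd_single {P : Set (Fin d → ℝ)} [Finite (Face P)] (v : Frame d) (F E : Face P) :
    (chains P v).bd (Finsupp.single F 1) E =
      (tgt P v F).indicator 1 E - (src P v F).indicator 1 E := by
  rw [← finsum_single_apply, ← finsum_single_apply, ← Finsupp.sub_apply]
  exact congrArg (· E) (linearCombination_single_one (B := Face P) (M := Face P →₀ ℤ) _ F)

/-- An identification of the sources and targets of cells of the cube with those of sign vectors. -/
structure IsLabelling (t : Fin n → ℝ) (ρ : ℕ → ℝ)
    (e : (Fin n → SignType) → (cubicalOriental n).B) : Prop where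
  bijective : Function.Bijective e
  deg_eq : ∀ X, (cubicalOriental n).deg (e X) = zeroCount X
  rel_iff : ∀ s X Y, (AtomSystem.cubical n).rel s (e X) (e Y) ↔ SignRel t ρ (boolSign s) X Y

lemma isLabelling_word {t : Fin n → ℝ} (ht : StrictMono t) :
    IsLabelling t (fun _ => 1) word :=
  ⟨⟨word_injective, word_surjective⟩, deg_word, cubical_rel_word ht⟩

lemma isLabelling_word_rev {t : Fin n → ℝ} (ht : StrictMono t) :
    IsLabelling t (fun m => (-1) ^ m) fun X => word (X ∘ Fin.rev) := by
  refine ⟨?_, fun X => (deg_word _).trans (zeroCount_rev X), cubical_rel_word_rev ht⟩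
  have h : Function.Bijective (word (n := n)) := ⟨word_injective, word_surjective⟩
  exact h.comp (Equiv.arrowCongr Fin.revPerm (Equiv.refl SignType)).bijective

section Zonotope

variable {v : Frame d} {ρ : ℕ → ℝ} (hv : IsDiagonal v ρ) {t : Fin n → ℝ}
  (ht : Function.Injective t) {e : (Fin n → SignType) → (cubicalOriental n).B}
  (he : IsLabelling t ρ e)
include hv ht he

lemma mem_tgt_iff_chain (F E : Face (cyclicZonotope d t)) : E ∈ tgt (cyclicZonotope d t) v F ↔
    ((cubicalOriental n).deg (e (signVec t E)) : ℤ) = (dim (F : Set (Fin d → ℝ)) : ℤ) - 1 ∧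
      (AtomSystem.cubical n).rel true (e (signVec t F)) (e (signVec t E)) := by
  rw [mem_tgt_iff hv ht, he.deg_eq, he.rel_iff, eq_sub_iff_add_eq]
  norm_cast

lemma mem_src_iff_chain (F E : Face (cyclicZonotope d t)) : E ∈ src (cyclicZonotope d t) v F ↔
    ((cubicalOriental n).deg (e (signVec t E)) : ℤ) = (dim (F : Set (Fin d → ℝ)) : ℤ) - 1 ∧
      (AtomSystem.cubical n).rel false (e (signVec t F)) (e (signVec t E)) := by
  rw [mem_src_iff hv ht, he.deg_eq, he.rel_iff, eq_sub_iff_add_eq]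
  norm_cast

lemma isTruncation_chains : IsTruncation (AtomSystem.cubical n) d
    (chains (cyclicZonotope d t) v) fun F => e (signVec t F) where
  injective := he.bijective.1.comp (signVec_injective t)
  deg_eq (F : Face (cyclicZonotope d t)) := by
    rw [he.deg_eq, ← dim_cell ht, ← face_eq_cell]
    rfl
  map_bd_single (F : Face (cyclicZonotope d t)) := by
    classical
    have hchain : ∀ s y, (AtomSystem.cubical n).chain s ((dim (F : Set (Fin d → ℝ)) : ℤ) - 1)
        (e (signVec t F)) y = if ((cubicalOriental n).deg y : ℤ) =
          (dim (F : Set (Fin d → ℝ)) : ℤ) - 1 ∧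
          (AtomSystem.cubical n).rel s (e (signVec t F)) y then 1 else 0 := by
      intro s y
      split_ifs with h
      · exact AtomSystem.chain_pos _ h.1 h.2
      · exact AtomSystem.chain_zero _ h
    ext y
    obtain ⟨Y, rfl⟩ := he.bijective.2 y
    change _ = ((AtomSystem.cubical n).chain true ((dim (F : Set (Fin d → ℝ)) : ℤ) - 1)
        (e (signVec t F)) - (AtomSystem.cubical n).chain false
          ((dim (F : Set (Fin d → ℝ)) : ℤ) - 1) (e (signVec t F))) (e Y)
    rw [Finsupp.sub_apply, hchain, hchain]
    by_cases hY : ∃ E : Face (cyclicZonotope d t), signVec t E = Y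
    · obtain ⟨E, rfl⟩ := hY
      refine (Finsupp.mapDomain_apply (he.bijective.1.comp (signVec_injective t)) _ E).trans ?_
      refine (chains_bd_single v F E).trans ?_
      rw [Set.indicator_apply, Set.indicator_apply]
      simp only [mem_tgt_iff_chain hv ht he, mem_src_iff_chain hv ht he, Pi.one_apply]
    · have hno : ∀ s, ¬ (((cubicalOriental n).deg (e Y) : ℤ) =
          (dim (F : Set (Fin d → ℝ)) : ℤ) - 1 ∧
          (AtomSystem.cubical n).rel s (e (signVec t F)) (e Y)) := by
        rintro s ⟨h1, h2⟩
        rw [he.deg_eq] at h1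
        have := dim_le (F : Set (Fin d → ℝ))
        -- `Y` has `dim F - 1` zeros, fewer than `d` even for a truncated `F`, so it would be
        -- realized by a face.
        exact hY (exists_face_of_signRel t ρ F (by omega) ((he.rel_iff s _ _).mp h2))
      rw [if_neg (hno true), if_neg (hno false), sub_self]
      apply Finsupp.mapDomain_of_notMem_range
      rintro ⟨E, hE⟩
      exact hY ⟨E, he.bijective.1 hE⟩

/-- Framed cyclic zonotopes have no inhomogeneous cellular loops. -/
lemma not_exists_isInhomogeneousLoop :
    ¬ ∃ l, IsInhomogeneousLoop (cyclicZonotope d t) v l := by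
  rintro ⟨l, hl, hdup⟩
  let r : Face (cyclicZonotope d t) → ℤ := fun F => (AtomSystem.cubical n).rank (e (signVec t F))
  have hdim : ∀ F E : Face (cyclicZonotope d t), ((cubicalOriental n).deg (e (signVec t E)) : ℤ) =
      (dim (F : Set (Fin d → ℝ)) : ℤ) - 1 → e (signVec t E) ≠ e (signVec t F) := by
    intro F E h heq
    have h1 : dim (F : Set (Fin d → ℝ)) ≤ _ := (isTruncation_chains hv ht he).deg_le F
    rw [← heq] at h1
    omega
  -- Each step of a string raises the rank of the cube, so no face can recur.
  have hlt : ∀ F G : Face (cyclicZonotope d t), (F ∈ src (cyclicZonotope d t) v G ∨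
      G ∈ tgt (cyclicZonotope d t) v F) → r F < r G := by
    rintro F G (h | h)
    · obtain ⟨h1, h2⟩ := (mem_src_iff_chain hv ht he G F).mp h
      simpa [r] using ((AtomSystem.cubical n).rank_lt h2).resolve_left (hdim G F h1)
    · obtain ⟨h1, h2⟩ := (mem_tgt_iff_chain hv ht he F G).mp h
      simpa [r] using ((AtomSystem.cubical n).rank_lt h2).resolve_left (hdim F G h1)
  have hchain : l.IsChain fun F G => r F < r G := List.IsChain.imp hlt hl
  have : IsTrans (Face (cyclicZonotope d t)) fun F G => r F < r G := ⟨fun _ _ _ => lt_trans⟩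
  refine hdup ((List.isChain_iff_pairwise.mp hchain).imp ?_)
  rintro F G h rfl
  exact lt_irrefl _ h

end Zonotope

lemma zeroCount_le (X : Fin n → SignType) : zeroCount X ≤ n := by
  rw [zeroCount_eq_card]
  exact (Fintype.card_subtype_le _).trans_eq (Fintype.card_fin n)

end FramedPolytope
end

/-! ### The main theorem -/

theorem mainTheorem6 :
    (∀ (d : ℕ) (t : Fin d → ℝ), StrictMono t →
      FramedPolytope.IsFramed (FramedPolytope.cyclicZonotope d t)
          (FramedPolytope.alternatingFrame d) ∧
      (¬ ∃ l : List (FramedPolytope.Face (FramedPolytope.cyclicZonotope d t)),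
        FramedPolytope.IsInhomogeneousLoop (FramedPolytope.cyclicZonotope d t)
          (FramedPolytope.alternatingFrame d) l) ∧
      (FramedPolytope.chains (FramedPolytope.cyclicZonotope d t)
        (FramedPolytope.alternatingFrame d)).IsStrongSteiner ∧
      (FramedPolytope.chains (FramedPolytope.cyclicZonotope d t)
        (FramedPolytope.alternatingFrame d)).Isomorphic (BasedChainData.cubicalOriental d)) ∧
    (∀ (n d : ℕ), d ≤ n → ∀ t : Fin n → ℝ, StrictMono t →
      FramedPolytope.IsFramed (FramedPolytope.cyclicZonotope d t)
          (FramedPolytope.canonicalFrame d) ∧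
      (FramedPolytope.chains (FramedPolytope.cyclicZonotope d t)
        (FramedPolytope.canonicalFrame d)).IsStrongSteiner) := by
  refine ⟨fun d t ht => ?_, fun n d _ t ht => ?_⟩
  · have hv := FramedPolytope.isDiagonal_alternatingFrame d
    have he := FramedPolytope.isLabelling_word_rev ht
    have hT := FramedPolytope.isTruncation_chains hv ht.injective he
    refine ⟨FramedPolytope.isFramed_cyclicZonotope hv ht.injective,
      FramedPolytope.not_exists_isInhomogeneousLoop hv ht.injective he, hT.isStrongSteiner,
      hT.isomorphic ?_ fun F => ?_⟩
    · exact he.bijective.comp ⟨FramedPolytope.signVec_injective t,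
        FramedPolytope.signVec_surjective ht.injective⟩
    · rw [he.deg_eq]
      exact FramedPolytope.zeroCount_le _
  · have hv := FramedPolytope.isDiagonal_canonicalFrame d
    have he := FramedPolytope.isLabelling_word ht
    exact ⟨FramedPolytope.isFramed_cyclicZonotope hv ht.injective,
      (FramedPolytope.isTruncation_chains hv ht.injective he).isStrongSteiner⟩
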